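/- All manifolds are smooth; four-manifolds and $S^2$ are oriented, and "complex coordinates" means smooth local coordinates with values in $\mathbb C$ or $\mathbb C^2$ that are compatible with the orientation. A \emph{symplectic Lefschetz fibration} (SLF) is a proper smooth map $q:M\to S^2$ from a four-manifold with finitely many critical points, lying in pairwise different fibers, such that near each critical point there are complex coordinates $(z,w)$ on $M$ and $t$ on $S^2$ in which $q$ is $(z,w)\mapsto zw$. The \emph{blow-up} $\sigma:\tilde X\to X$ of a four-manifold in a point $P$, formed in complex coordinates $(z,w)$ centered at $P$, is an oriented diffeomorphism away from $P$ and is the complex blow-up of the origin over the domain of $(z,w)$. For a map $f:X\to S^2$ we say that the blow-up is \emph{adapted to $f$} if there are a complex coordinate $t$ on $S^2$ and integers $m,n\ge 0$ with $m+n\ge1$ such that $t\circ f=z^mw^n$ on the domain of $(z,w)$ (for example $z$ at a regular point, $zw$ at a node). Blow-ups may be iterated finitely often, and $f$ is replaced by the induced map $f\circ\sigma$ at each step. A \emph{symplectic fiber bundle} over $S^2$ is a smooth fiber bundle with four-dimensional total space whose fiber is a closed surface $F$ with a symplectic form and whose structure group consists of symplectomorphisms of $F$. A \emph{branched covering} $\kappa: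 X'\to X$ of four-manifolds is a proper surjective smooth map such that around each $P\in X$ there are complex coordinates $(z,w)$ centered at $P$ in which, near each $Q\in\kappa^{-1}(P)$ and in suitable complex coordinates $(u,w)$, $\kappa$ is $(u,w)\mapsto(z,w)=(u^b,w)$ for some $b=b_Q\ge1$. The branch locus is the image of the critical points of $\kappa$; it is an embedded surface. \textbf{Theorem.} Let $q:M\to S^2$ be an SLF, and let $\sigma:\tilde M\to M$ be a (finitely iterated) blow-up adapted to the fibration. Suppose that $q\circ\sigma$ factors as $$\tilde M\xrightarrow{\ \tilde\kappa\ }N\xrightarrow{\ p\ }S^2,$$ where $\tilde\kappa$ is a branched covering (of any degree and any branch orders) and $p:N\to S^2$ is a (finitely iterated) blow-up of a symplectic fiber bundle. Let $B\subset N$ be the union of the non-vertical components of the branch locus of $\tilde\kappa$, i.e. of those connected components that are not contained in a fiber of $p$, and assume $B\cap\mathrm{Crit}(p)=\emptyset$. Let $\omega_N$ be a symplectic form on $N$ for which the fibers of $p$ are symplectic, in the sense that at each $x\in N\setminus\mathrm{Crit}(p)$ the form $\omega_N$ is positive on $\ker dp_x$ with its orientation induced from $N$ and $S^2$. Let $\omega_{S^2}$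 be a symplectic form on $S^2$ that is positive with respect to the orientation of $S^2$. Then there is $k_0\in\mathbb R$ such that for every real $k\ge k_0$ the surface $B$ is symplectic with respect to $\omega_N+k\,p^*\omega_{S^2}$: $B$ is an embedded surface, and the restriction of this form to $T_xB$ is non-degenerate for every $x\in B$. -/

import Mathlib

universe u v

open Set
open scoped Manifold ContDiff

/-! ## Orientations -/

/-- A linear map between oriented real vector spaces is an orientation preserving isomorphism. -/
def IsOrientedIso {n : ℕ} {V W : Type*} [AddCommGroup V] [Module ℝ V] [AddCommGroup W] [Module ℝ W]
    (oV : Orientation ℝ V (Fin n)) (oW : Orientation ℝ W (Fin n)) (L : V → W) : Prop :=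
  ∃ e : V ≃ₗ[ℝ] W, (∀ v, e v = L v) ∧ Orientation.map (Fin n) e oV = oW

/-- The vectors `v` form a positively oriented basis. -/
def IsPositiveFrame {n : ℕ} {V : Type*} [AddCommGroup V] [Module ℝ V]
    (o : Orientation ℝ V (Fin n)) (v : Fin n → V) : Prop :=
  ∃ b : Module.Basis (Fin n) ℝ V, (∀ i, b i = v i) ∧ b.orientation = o

/-- The standard orientation of `ℝⁿ`. -/
noncomputable def euclideanOrientation (n : ℕ) : Orientation ℝ (EuclideanSpace ℝ (Fin n)) (Fin n) :=
  (EuclideanSpace.basisFun (Fin n) ℝ).toBasis.orientation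

/-- The complex orientation of `ℂ²`, given by the real basis `(1,0), (i,0), (0,1), (0,i)`. -/
noncomputable def complexOrientation₂ : Orientation ℝ (ℂ × ℂ) (Fin 4) :=
  Module.Basis.orientation
    ((Complex.basisOneI.prod Complex.basisOneI).reindex (finSumFinEquiv : Fin 2 ⊕ Fin 2 ≃ Fin 4))

/-- An orientation of a smooth `n`-manifold: an orientation of each tangent space such that
around every point there are smooth coordinates in which it is the standard orientation. -/
structure ManifoldOrientation (n : ℕ) (X : Type*) [TopologicalSpace X]
    [ChartedSpace (EuclideanSpace ℝ (Fin n)) X] where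
  /-- the orientation of the tangent space at a point -/
  at' : ∀ x : X, Orientation ℝ (TangentSpace (𝓡 n) x) (Fin n)
  locally_standard : ∀ x : X,
    ∃ Φ : PartialDiffeomorph (𝓡 n) (𝓡 n) X (EuclideanSpace ℝ (Fin n)) ∞, x ∈ Φ.source ∧
      ∀ y ∈ Φ.source,
        IsOrientedIso (at' y) (euclideanOrientation n) (mfderiv (𝓡 n) (𝓡 n) Φ y)

/-- Local complex coordinates `t` on an oriented surface, compatible with the orientation. -/
def IsOrientedChart₁ {X : Type*} [TopologicalSpace X] [ChartedSpace (EuclideanSpace ℝ (Fin 2)) X]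
    (o : ManifoldOrientation 2 X) (t : PartialDiffeomorph (𝓡 2) 𝓘(ℝ, ℂ) X ℂ ∞) : Prop :=
  ∀ y ∈ t.source, IsOrientedIso (o.at' y) Complex.orientation (mfderiv (𝓡 2) 𝓘(ℝ, ℂ) t y)

/-- Local complex coordinates `φ = (z, w)` on an oriented four-manifold, compatible with the
orientation. -/
def IsOrientedChart₂ {X : Type*} [TopologicalSpace X] [ChartedSpace (EuclideanSpace ℝ (Fin 4)) X]
    (o : ManifoldOrientation 4 X)
    (φ : PartialDiffeomorph (𝓡 4) 𝓘(ℝ, ℂ × ℂ) X (ℂ × ℂ) ∞) : Prop :=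
  ∀ y ∈ φ.source, IsOrientedIso (o.at' y) complexOrientation₂ (mfderiv (𝓡 4) 𝓘(ℝ, ℂ × ℂ) φ y)

/-! ## Differential two-forms -/

/-- A (not necessarily continuous) differential 2-form on a manifold. -/
abbrev TwoForm (n : ℕ) (X : Type*) [TopologicalSpace X]
    [ChartedSpace (EuclideanSpace ℝ (Fin n)) X] :=
  ∀ x : X, (TangentSpace (𝓡 n) x) [⋀^Fin 2]→L[ℝ] ℝ

/-- The 2-form `η` in the preferred coordinates around `x`; only its values on the
(open) range of the coordinates matter. -/
noncomputable def TwoForm.inChart {n : ℕ} {X : Type*} [TopologicalSpace X]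
    [ChartedSpace (EuclideanSpace ℝ (Fin n)) X] (η : TwoForm n X) (x : X) :
    EuclideanSpace ℝ (Fin n) → (EuclideanSpace ℝ (Fin n)) [⋀^Fin 2]→L[ℝ] ℝ :=
  fun y => (η ((extChartAt (𝓡 n) x).symm y)).compContinuousLinearMap
    (mfderiv (𝓡 n) (𝓡 n) (extChartAt (𝓡 n) x).symm y)

/-- The pull-back of a 2-form under a map. -/
noncomputable def TwoForm.pullback {m n : ℕ} {X Y : Type*} [TopologicalSpace X]
    [ChartedSpace (EuclideanSpace ℝ (Fin m)) X] [TopologicalSpace Y]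
    [ChartedSpace (EuclideanSpace ℝ (Fin n)) Y] (η : TwoForm n Y) (f : X → Y) : TwoForm m X :=
  fun x => (η (f x)).compContinuousLinearMap (mfderiv (𝓡 m) (𝓡 n) f x)

/-- A symplectic form: a smooth, closed, non-degenerate 2-form. -/
structure IsSymplecticForm {n : ℕ} {X : Type*} [TopologicalSpace X]
    [ChartedSpace (EuclideanSpace ℝ (Fin n)) X] (η : TwoForm n X) : Prop where
  smooth : ∀ x : X, ContDiffOn ℝ ∞ (TwoForm.inChart η x) (extChartAt (𝓡 n) x).target
  closed : ∀ x : X, ∀ y ∈ (extChartAt (𝓡 n) x).target, extDeriv (TwoForm.inChart η x) y = 0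
  nondegenerate : ∀ (x : X) (v : TangentSpace (𝓡 n) x), (∀ w, η x ![v, w] = 0) → v = 0

/-- `B` is a symplectic surface in the four-manifold `X` with respect to `Ω`: it is an embedded
surface, i.e. locally given by `z = 0` in smooth coordinates `(z, w) ∈ ℂ²`, and the restriction of
`Ω` to the tangent plane `T_x B = ker dz` is non-degenerate at every point `x` of `B`. -/
def IsSymplecticSurface {X : Type*} [TopologicalSpace X]
    [ChartedSpace (EuclideanSpace ℝ (Fin 4)) X] (Ω : TwoForm 4 X) (B : Set X) : Prop :=
  ∀ x ∈ B, ∃ φ : PartialDiffeomorph (𝓡 4) 𝓘(ℝ, ℂ × ℂ) X (ℂ × ℂ) ∞, x ∈ φ.source ∧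
    (∀ y ∈ φ.source, y ∈ B ↔ (φ y).1 = 0) ∧
    ∀ v : TangentSpace (𝓡 4) x,
      (mfderiv (𝓡 4) 𝓘(ℝ, ℂ × ℂ) φ x v : ℂ × ℂ).1 = 0 → v ≠ 0 →
        ∃ w : TangentSpace (𝓡 4) x,
          (mfderiv (𝓡 4) 𝓘(ℝ, ℂ × ℂ) φ x w : ℂ × ℂ).1 = 0 ∧ Ω x ![v, w] ≠ 0

/-! ## Four-manifolds mapping to the sphere -/

/-- The two-sphere. -/
abbrev S2 : Type := Metric.sphere (0 : EuclideanSpace ℝ (Fin 3)) 1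

/-- An oriented smooth four-manifold (without boundary) with a smooth map to `S²`. -/
structure FourManifoldOverS2 where
  carrier : Type*
  [topologicalSpace : TopologicalSpace carrier]
  [t2Space : T2Space carrier]
  [secondCountable : SecondCountableTopology carrier]
  [chartedSpace : ChartedSpace (EuclideanSpace ℝ (Fin 4)) carrier]
  [isManifold : IsManifold (𝓡 4) ∞ carrier]
  orientation : ManifoldOrientation 4 carrier
  /-- the map to the sphere -/
  proj : carrier → S2
  contMDiff_proj : ContMDiff (𝓡 4) (𝓡 2) ∞ proj

instance : CoeSort FourManifoldOverS2 (Type _) := ⟨FourManifoldOverS2.carrier⟩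

attribute [instance] FourManifoldOverS2.topologicalSpace FourManifoldOverS2.t2Space
  FourManifoldOverS2.secondCountable FourManifoldOverS2.chartedSpace FourManifoldOverS2.isManifold

/-- The critical points of a map: its differential is not surjective. -/
def critSet {m n : ℕ} {X Y : Type*} [TopologicalSpace X]
    [ChartedSpace (EuclideanSpace ℝ (Fin m)) X] [TopologicalSpace Y]
    [ChartedSpace (EuclideanSpace ℝ (Fin n)) Y] (f : X → Y) : Set X :=
  {x | ¬ Function.Surjective (mfderiv (𝓡 m) (𝓡 n) f x)}

/-- A symplectic Lefschetz fibration over the sphere with orientation `oS`: proper, finitely many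
critical points, in distinct fibers, near each of which the map is `(z, w) ↦ z w` in
complex coordinates compatible with the orientations. -/
structure IsSLF (oS : ManifoldOrientation 2 S2) (M : FourManifoldOverS2) : Prop where
  proper : IsProperMap M.proj
  finite : (critSet (m := 4) (n := 2) M.proj).Finite
  disjoint_fibers : InjOn M.proj (critSet (m := 4) (n := 2) M.proj)
  lefschetz : ∀ Q ∈ critSet (m := 4) (n := 2) M.proj,
    ∃ (φ : PartialDiffeomorph (𝓡 4) 𝓘(ℝ, ℂ × ℂ) M (ℂ × ℂ) ∞)
      (t : PartialDiffeomorph (𝓡 2) 𝓘(ℝ, ℂ) S2 ℂ ∞),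
      IsOrientedChart₂ M.orientation φ ∧ IsOrientedChart₁ oS t ∧
      Q ∈ φ.source ∧ MapsTo M.proj φ.source t.source ∧
      ∀ y ∈ φ.source, t (M.proj y) = (φ y).1 * (φ y).2

/-! ## Blow-ups -/

/-- `σ : X' → X` is the blow-up of the oriented four-manifold `X` in the point `P`, formed with
respect to the complex coordinates `φ = (z, w)` centered at `P`. Away from `P` it is an oriented
diffeomorphism, and over the domain of `φ` it is the complex blow-up of the origin, which is glued
from the coordinate patches `(a, b) ↦ (z, w) = (a, a b)` and `(a, b) ↦ (z, w) = (a b, b)`. -/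
structure IsBlowUpInChart {X' X : FourManifoldOverS2} (σ : X' → X) (P : X)
    (φ : PartialDiffeomorph (𝓡 4) 𝓘(ℝ, ℂ × ℂ) X (ℂ × ℂ) ∞) : Prop where
  contMDiff : ContMDiff (𝓡 4) (𝓡 4) ∞ σ
  oriented_chart : IsOrientedChart₂ X.orientation φ
  mem_source : P ∈ φ.source
  centered : φ P = 0
  bijOn : BijOn σ {x | σ x ≠ P} {y | y ≠ P}
  oriented : ∀ x, σ x ≠ P → IsOrientedIso (X'.orientation.at' x) (X.orientation.at' (σ x))
    (mfderiv (𝓡 4) (𝓡 4) σ x)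
  blowUp : ∃ ψ₁ ψ₂ : PartialDiffeomorph (𝓡 4) 𝓘(ℝ, ℂ × ℂ) X' (ℂ × ℂ) ∞,
    IsOrientedChart₂ X'.orientation ψ₁ ∧ IsOrientedChart₂ X'.orientation ψ₂ ∧
    ψ₁.source ∪ ψ₂.source = σ ⁻¹' φ.source ∧
    ψ₁.target = {c | (c.1, c.1 * c.2) ∈ φ.target} ∧
    ψ₂.target = {c | (c.1 * c.2, c.2) ∈ φ.target} ∧
    (∀ x ∈ ψ₁.source, φ (σ x) = ((ψ₁ x).1, (ψ₁ x).1 * (ψ₁ x).2)) ∧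
    (∀ x ∈ ψ₂.source, φ (σ x) = ((ψ₂ x).1 * (ψ₂ x).2, (ψ₂ x).2)) ∧
    (∀ x ∈ ψ₁.source, x ∈ ψ₂.source ↔ (ψ₁ x).2 ≠ 0) ∧
    (∀ x ∈ ψ₁.source ∩ ψ₂.source, ψ₂ x = ((ψ₁ x).2⁻¹, (ψ₁ x).1 * (ψ₁ x).2))

/-- The coordinates `φ = (z, w)` on `X` are adapted to the map `X → S²`: in a complex coordinate `t`
on the oriented sphere centered at the image point, the map is a non-constant monomial `z ^ m w ^ n`
(for instance `z` at a regular point, and `z w` at a node). -/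
def IsAdaptedChart (oS : ManifoldOrientation 2 S2) {X : FourManifoldOverS2}
    (φ : PartialDiffeomorph (𝓡 4) 𝓘(ℝ, ℂ × ℂ) X (ℂ × ℂ) ∞) : Prop :=
  ∃ (t : PartialDiffeomorph (𝓡 2) 𝓘(ℝ, ℂ) S2 ℂ ∞) (m n : ℕ),
    IsOrientedChart₁ oS t ∧ 1 ≤ m + n ∧ MapsTo X.proj φ.source t.source ∧
    ∀ y ∈ φ.source, t (X.proj y) = (φ y).1 ^ m * (φ y).2 ^ n

/-- `X'` is obtained from `X` by blowing up one point, with the induced map to `S²`. -/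
def BlowUpStep (X' X : FourManifoldOverS2.{u}) : Prop :=
  ∃ (σ : X' → X) (P : X) (φ : PartialDiffeomorph (𝓡 4) 𝓘(ℝ, ℂ × ℂ) X (ℂ × ℂ) ∞),
    IsBlowUpInChart σ P φ ∧ ∀ x, X'.proj x = X.proj (σ x)

/-- `X'` is obtained from `X` by blowing up one point in complex coordinates adapted to the
fibration, with the induced map to `S²`. -/
def FiberedBlowUpStep (oS : ManifoldOrientation 2 S2) (X' X : FourManifoldOverS2.{u}) : Prop :=
  ∃ (σ : X' → X) (P : X) (φ : PartialDiffeomorph (𝓡 4) 𝓘(ℝ, ℂ × ℂ) X (ℂ × ℂ) ∞),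
    IsBlowUpInChart σ P φ ∧ IsAdaptedChart oS φ ∧ ∀ x, X'.proj x = X.proj (σ x)

/-- `X'` is a (finitely iterated) blow-up of `X`. -/
def IsBlowUp (X' X : FourManifoldOverS2.{u}) : Prop :=
  Relation.ReflTransGen BlowUpStep X' X

/-- `X'` is a (finitely iterated) blow-up of `X`, formed in complex coordinates adapted to the
fibration structure. -/
def IsFiberedBlowUp (oS : ManifoldOrientation 2 S2) (X' X : FourManifoldOverS2.{u}) : Prop :=
  Relation.ReflTransGen (FiberedBlowUpStep oS) X' X

/-! ## Symplectic fiber bundles -/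

/-- `X → S²` is a symplectic fiber bundle: a smooth fiber bundle whose fiber is a closed surface `F`
with a symplectic form `ωF`, and whose structure group is the group of symplectomorphisms of
`(F, ωF)`. The latter means that the fibers carry forms (here: the restrictions of `τ`) to which
`ωF` corresponds under all the local trivializations `Φ`. -/
def IsSymplecticFiberBundle (X : FourManifoldOverS2.{u}) : Prop :=
  ∃ (F : Type u) (_ : TopologicalSpace F) (_ : T2Space F) (_ : CompactSpace F)
    (_ : SecondCountableTopology F)
    (_ : ChartedSpace (EuclideanSpace ℝ (Fin 2)) F) (_ : IsManifold (𝓡 2) ∞ F)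
    (ωF : TwoForm 2 F) (τ : TwoForm 4 X), IsSymplecticForm ωF ∧
    ∀ s₀ : S2, ∃ (U : Set S2)
      (Φ : PartialDiffeomorph ((𝓡 2).prod (𝓡 2)) (𝓡 4) (S2 × F) X ∞),
      s₀ ∈ U ∧ Φ.source = U ×ˢ univ ∧ Φ.target = X.proj ⁻¹' U ∧
      ∀ s ∈ U, ∀ y : F, X.proj (Φ (s, y)) = s ∧
        ∀ v w : TangentSpace (𝓡 2) y,
          τ (Φ (s, y)) ![mfderiv (𝓡 2) (𝓡 4) (fun y' => Φ (s, y')) y v,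
            mfderiv (𝓡 2) (𝓡 4) (fun y' => Φ (s, y')) y w] = ωF y ![v, w]

/-! ## Branched coverings -/

/-- `κ : X' → X` is an oriented branched covering of four-manifolds, of any degree and any branch
orders, branched along an embedded surface: around each point `P` of `X` there are complex
coordinates `(z, w)` such that near each preimage of `P` the map is `(u, w) ↦ (u ^ b, w)` in
suitable complex coordinates, for some `b ≥ 1`; `b` may depend on the preimage. -/
structure IsBranchedCovering {X' X : FourManifoldOverS2} (κ : X' → X) : Prop where
  contMDiff : ContMDiff (𝓡 4) (𝓡 4) ∞ κ
  proper : IsProperMap κ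
  surjective : Function.Surjective κ
  local_model : ∀ P : X, ∃ φ : PartialDiffeomorph (𝓡 4) 𝓘(ℝ, ℂ × ℂ) X (ℂ × ℂ) ∞,
    IsOrientedChart₂ X.orientation φ ∧ P ∈ φ.source ∧ φ P = 0 ∧
    ∀ Q : X', κ Q = P → ∃ (ψ : PartialDiffeomorph (𝓡 4) 𝓘(ℝ, ℂ × ℂ) X' (ℂ × ℂ) ∞) (b : ℕ),
      IsOrientedChart₂ X'.orientation ψ ∧ Q ∈ ψ.source ∧ 1 ≤ b ∧ MapsTo κ ψ.source φ.source ∧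
      ∀ y ∈ ψ.source, φ (κ y) = ((ψ y).1 ^ b, (ψ y).2)

/-- The branch locus: the image of the set of critical points. -/
def branchLocus {X' X : FourManifoldOverS2} (κ : X' → X) : Set X :=
  κ '' critSet (m := 4) (n := 4) κ

/-- The union of the non-vertical connected components of the branch locus, i.e. of those that
are not contained in a fiber of `X → S²`. -/
def nonVerticalBranchLocus {X' X : FourManifoldOverS2} (κ : X' → X) : Set X :=
  {x | x ∈ branchLocus κ ∧
    ¬ ∃ s : S2, ∀ y ∈ connectedComponentIn (branchLocus κ) x, X.proj y = s}

/-! ## Compatibility of forms with orientations -/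

/-- The 2-form `η` on an oriented surface is positive. -/
def IsPositiveForm {X : Type*} [TopologicalSpace X] [ChartedSpace (EuclideanSpace ℝ (Fin 2)) X]
    (o : ManifoldOrientation 2 X) (η : TwoForm 2 X) : Prop :=
  ∀ (x : X) (v : Fin 2 → TangentSpace (𝓡 2) x), IsPositiveFrame (o.at' x) v → 0 < η x v

/-- The fibers of `X → S²` are symplectic with respect to `η`: at each non-critical point, `η` is
positive on the tangent plane `ker dp` of the fiber, which is oriented by the orientations of the
base (spanned by the images of `h₁, h₂`) and of the total space. -/
def HasSymplecticFibers (oS : ManifoldOrientation 2 S2) (X : FourManifoldOverS2) (η : TwoForm 4 X) :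
    Prop :=
  ∀ x : X, x ∉ critSet (m := 4) (n := 2) X.proj → ∀ h₁ h₂ v₁ v₂ : TangentSpace (𝓡 4) x,
    mfderiv (𝓡 4) (𝓡 2) X.proj x v₁ = 0 → mfderiv (𝓡 4) (𝓡 2) X.proj x v₂ = 0 →
    IsPositiveFrame (oS.at' (X.proj x))
      ![mfderiv (𝓡 4) (𝓡 2) X.proj x h₁, mfderiv (𝓡 4) (𝓡 2) X.proj x h₂] →
    IsPositiveFrame (X.orientation.at' x) ![h₁, h₂, v₁, v₂] →
    0 < η x ![v₁, v₂]

/-!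
Write `q : M' → S²` for the blown-up Lefschetz fibration, `p : N → S²` for the blown-up bundle and
`κ : M' → N` for the branched covering, so that `q = p ∘ κ`, and let `B` be the non-vertical part
of the branch locus. Since `M'` is compact and `B` is closed, the claim is local on `B`: around
each `P ∈ B` a single constant `k₀` has to work (`eventually_perturbed_ne_zero`). In the local
model `κ (u, w) = (u ^ b, w)` with `b ≥ 2`, the surface `B` is the line `z = 0`, and one compares
the values `G` of `ω_N` and `H` of `p^* ω_S` on the basis `1, i` of the `w`-plane.

If `H` does not vanish at `P`, then `G + k H` does not vanish near `P` for large `k`. Otherwise the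
corresponding point `Q` of `M'` is critical for `q`, and there `q` is a monomial in complex
coordinates that are compatible with the orientations: this holds for a Lefschetz fibration and
persists under adapted blow-ups (`FiberedBlowUpStep.isMonomialAt`). As monomials have rank zero or
two, `B` is tangent to the fiber at `P`. The orientation of the fiber differs from the complex
orientation of the `w`-plane by the sign of `det A`, where `A = ∂p / ∂z`, so that `G` has this
sign near `P`, and it remains to see that `H` does not have the opposite sign, i.e. that
`det A * det (∂p / ∂w) ≥ 0` along `B` (`eventually_nonneg_of_monomial`).

If the monomial has a multiple factor vanishing at `Q`, then the zeros of this factor are a germ of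
a surface of critical points of `q`. All critical points of `q` near `Q` lie on `u = 0`, so the two
germs agree and `p` is constant to first order along `B`
(`eventually_fderiv_eq_zero_of_multiple_factor`). Otherwise `Q` is a node. Then the second-order
part of `q` is a complex quadratic form `ℓ₁ ℓ₂` for an orientation compatible complex structure on
`ℂ²`, and it splits as `A u² + K(w)`. The two coordinate planes are orthogonal for it and hence are
complex lines for this structure (`complex_lines_of_orthogonal`). Its orientation is standard on
`ℂ²`, so it is standard on both planes or on neither; the restrictions of the quadratic form being
holomorphic, the differentials of `A u²` and `K(w)` have the same sign
(`eventually_nonneg_of_node`).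
-/

open Filter Topology

/-! ### Determinants in the plane and in `ℂ²`, and the linear algebra of a node -/

/-- The real determinant of two complex numbers with respect to the basis `1, i`. -/
noncomputable def det₂ (x y : ℂ) : ℝ := x.re * y.im - x.im * y.re

/-- The real determinant of four vectors of `ℂ²` with respect to `(1,0), (i,0), (0,1), (0,i)`. -/
noncomputable def det₄ (a b c d : ℂ × ℂ) : ℝ :=
  Matrix.det !![a.1.re, b.1.re, c.1.re, d.1.re; a.1.im, b.1.im, c.1.im, d.1.im;
    a.2.re, b.2.re, c.2.re, d.2.re; a.2.im, b.2.im, c.2.im, d.2.im]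

lemma det₄_of_proportional (p r : ℂ × ℂ) (ρ τ : ℂ) :
    det₄ p (ρ * p.1, ρ * p.2) r (τ * r.1, τ * r.2) =
      ρ.im * τ.im * Complex.normSq (p.1 * r.2 - p.2 * r.1) := by
  simp [det₄, Matrix.det_succ_row_zero, Fin.sum_univ_succ, Complex.normSq_apply, Fin.succAbove]
  ring

lemma det₄_prod (a b : ℂ) : det₄ (a, 0) (b, 0) (0, 1) (0, Complex.I) = det₂ a b := by
  simp [det₄, Matrix.det_succ_row_zero, Fin.sum_univ_succ, Fin.succAbove, det₂]
  ring

lemma det₄_prod_swap (a b : ℂ) : det₄ (a, 0) (b, 0) (0, Complex.I) (0, 1) = - det₂ a b := by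
  simp [det₄, Matrix.det_succ_row_zero, Fin.sum_univ_succ, Fin.succAbove, det₂]
  ring

lemma det₂_mul_self (x τ : ℂ) : det₂ x (τ * x) = Complex.normSq x * τ.im := by
  simp [det₂, Complex.normSq_apply]; ring

lemma det₂_add_right (x y z : ℂ) : det₂ x (y + z) = det₂ x y + det₂ x z := by
  simp [det₂]; ring

lemma abs_det₂_le (x y : ℂ) : |det₂ x y| ≤ ‖x‖ * ‖y‖ := by
  have : det₂ x y = (starRingEnd ℂ x * y).im := by simp [det₂]; ring
  rw [this]
  refine (Complex.abs_im_le_norm _).trans ?_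
  simp

lemma det₂_smul_smul (t : ℝ) (x y : ℂ) : det₂ (t • x) (t • y) = t ^ 2 * det₂ x y := by
  simp [det₂]; ring

lemma Complex.eq_re_smul_add_im_smul (z : ℂ) : z = z.re • (1 : ℂ) + z.im • Complex.I := by
  apply Complex.ext <;> simp

lemma Complex.prod_decomp (X : ℂ × ℂ) : X = X.1.re • ((1 : ℂ), (0 : ℂ)) +
    X.1.im • (Complex.I, (0 : ℂ)) + X.2.re • ((0 : ℂ), (1 : ℂ)) +
    X.2.im • ((0 : ℂ), Complex.I) := by
  apply Prod.ext <;> apply Complex.ext <;> simp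

/-- A linear endomorphism of `ℂ²` whose real determinant is non-zero is injective. -/
lemma injective_of_det₄_ne_zero (L : ℂ × ℂ →L[ℝ] ℂ × ℂ)
    (h : det₄ (L (1, 0)) (L (Complex.I, 0)) (L (0, 1)) (L (0, Complex.I)) ≠ 0) :
    Function.Injective L := by
  refine (injective_iff_map_eq_zero L).2 fun X hX => ?_
  have hX' := hX
  rw [Complex.prod_decomp X] at hX'
  simp only [map_add, map_smul] at hX'
  have key := Matrix.eq_zero_of_mulVec_eq_zero (v := ![X.1.re, X.1.im, X.2.re, X.2.im]) h (by
    have h1 := congrArg (fun z : ℂ × ℂ => z.1.re) hX'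
    have h2 := congrArg (fun z : ℂ × ℂ => z.1.im) hX'
    have h3 := congrArg (fun z : ℂ × ℂ => z.2.re) hX'
    have h4 := congrArg (fun z : ℂ × ℂ => z.2.im) hX'
    simp at h1 h2 h3 h4
    funext i
    fin_cases i
    · simp [Matrix.mulVec, dotProduct, Fin.sum_univ_succ]; linarith
    · simp [Matrix.mulVec, dotProduct, Fin.sum_univ_succ]; linarith
    · simp [Matrix.mulVec, dotProduct, Fin.sum_univ_succ]; linarith
    · simp [Matrix.mulVec, dotProduct, Fin.sum_univ_succ]; linarith)
  have k0 := congrFun key 0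
  have k1 := congrFun key 1
  have k2 := congrFun key 2
  have k3 := congrFun key 3
  simp at k0 k1 k2 k3
  rw [Complex.prod_decomp X, k0, k1, k2, k3]
  simp

/-- If the real planes spanned by `p, q` and by `r, s` are orthogonal for the complex quadratic form
`z w`, then both are complex lines; the product of the orientations given by the bases `p, q` and
`r, s` then is the orientation of `ℂ²` given by `p, q, r, s`. -/
lemma complex_lines_of_orthogonal {p q r s : ℂ × ℂ}
    (hpr : p.1 * r.2 + p.2 * r.1 = 0) (hps : p.1 * s.2 + p.2 * s.1 = 0)
    (hqr : q.1 * r.2 + q.2 * r.1 = 0) (hdet : 0 < det₄ p q r s) :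
    ∃ ρ τ : ℂ, q = (ρ * p.1, ρ * p.2) ∧ s = (τ * r.1, τ * r.2) ∧ 0 < ρ.im * τ.im ∧
      p.1 * p.2 ≠ 0 ∧ r.1 * r.2 ≠ 0 := by
  obtain ⟨ρ, τ, hq, hs⟩ : ∃ ρ τ : ℂ, q = (ρ * p.1, ρ * p.2) ∧ s = (τ * r.1, τ * r.2) := by
    have hp : p ≠ 0 := by
      rintro rfl
      simp [det₄, Matrix.det_succ_row_zero, Fin.sum_univ_succ, Fin.succAbove] at hdet
    have hr : r ≠ 0 := by
      rintro rfl
      simp [det₄, Matrix.det_succ_row_zero, Fin.sum_univ_succ, Fin.succAbove] at hdet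
    by_cases h1 : r.1 = 0
    · have hr2 : r.2 ≠ 0 := fun h => hr (Prod.ext h1 h)
      have hp1 : p.1 = 0 := by simpa [h1, hr2] using hpr
      have hp2 : p.2 ≠ 0 := fun h => hp (Prod.ext hp1 h)
      have hq1 : q.1 = 0 := by simpa [h1, hr2] using hqr
      have hs1 : s.1 = 0 := by simpa [hp1, hp2] using hps
      refine ⟨q.2 / p.2, s.2 / r.2, Prod.ext ?_ ?_, Prod.ext ?_ ?_⟩
      · simp [hq1, hp1]
      · simp [hp2]
      · simp [hs1, h1]
      · simp [hr2]
    · have hp2' : p.2 = - (p.1 * r.2) / r.1 := by field_simp; linear_combination hpr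
      have hp1 : p.1 ≠ 0 := fun h => hp (Prod.ext h (by rw [hp2', h]; simp))
      have hq2 : q.2 = - (q.1 * r.2) / r.1 := by field_simp; linear_combination hqr
      have hs2 : s.2 = - (p.2 * s.1) / p.1 := by field_simp; linear_combination hps
      refine ⟨q.1 / p.1, s.1 / r.1, Prod.ext ?_ ?_, Prod.ext ?_ ?_⟩
      · simp [hp1]
      · simp only [hq2, hp2']; field_simp
      · simp [h1]
      · simp only [hs2, hp2']; field_simp
  refine ⟨ρ, τ, hq, hs, ?_⟩
  rw [hq, hs, det₄_of_proportional] at hdet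
  have hpos : 0 < ρ.im * τ.im := pos_of_mul_pos_left hdet (Complex.normSq_nonneg _)
  have hne : p.1 * r.2 - p.2 * r.1 ≠ 0 := by
    intro h; rw [h] at hdet; simp at hdet
  have h2 : p.1 * r.2 ≠ 0 := fun h => hne (by linear_combination 2 * h - hpr)
  have h3 : p.2 * r.1 ≠ 0 := fun h => hne (by linear_combination hpr - 2 * h)
  exact ⟨hpos, mul_ne_zero (left_ne_zero_of_mul h2) (left_ne_zero_of_mul h3),
    mul_ne_zero (right_ne_zero_of_mul h3) (right_ne_zero_of_mul h2)⟩

/-! ### A fibration with a multiple factor along a branch locus -/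

lemma ContinuousAt.det₂ {E : Type*} [TopologicalSpace E] {x y : E → ℂ} {e : E}
    (hx : ContinuousAt x e) (hy : ContinuousAt y e) :
    ContinuousAt (fun e => det₂ (x e) (y e)) e := by
  unfold _root_.det₂
  have r1 := Complex.continuous_re.continuousAt.comp hx
  have i1 := Complex.continuous_im.continuousAt.comp hx
  have r2 := Complex.continuous_re.continuousAt.comp hy
  have i2 := Complex.continuous_im.continuousAt.comp hy
  exact (r1.mul i2).sub (i1.mul r2)

/-- The derivative of the branched covering `(u, w) ↦ (u ^ b, w)`. -/
lemma hasFDerivAt_branch (b : ℕ) (X : ℂ × ℂ) :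
    HasFDerivAt (fun X : ℂ × ℂ => (X.1 ^ b, X.2))
      (((((b : ℂ) * X.1 ^ (b - 1)) • (ContinuousLinearMap.fst ℝ ℂ ℂ))).prod
        (ContinuousLinearMap.snd ℝ ℂ ℂ)) X := by
  refine HasFDerivAt.prodMk ?_ hasFDerivAt_snd
  refine ((hasFDerivAt_fst (𝕜 := ℝ) (p := X)).pow b).congr_fderiv ?_
  rw [nsmul_eq_mul]

/-- The derivative of a monomial in two complex functions. -/
lemma hasFDerivAt_monomial {E : Type*} [NormedAddCommGroup E] [NormedSpace ℝ E] {a c : E → ℂ}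
    {a' c' : E →L[ℝ] ℂ} {X : E} (m n : ℕ) (ha : HasFDerivAt a a' X) (hc : HasFDerivAt c c' X) :
    HasFDerivAt (fun X => a X ^ m * c X ^ n)
      (((m : ℂ) * a X ^ (m - 1) * c X ^ n) • a' + ((n : ℂ) * a X ^ m * c X ^ (n - 1)) • c') X := by
  refine ((ha.pow m).mul (hc.pow n)).congr_fderiv ?_
  ext v
  simp
  ring

/-- If `(u, w) ↦ f (u ^ b, w)` is critical at a point while `f` is submersive in the direction of
`u`, then the point lies on the branch locus `u = 0` and `f` is critical in the direction of `w`. -/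
lemma eq_zero_of_fderiv_branch_eq_zero {f : ℂ × ℂ → ℂ} {b : ℕ} (hb : 1 ≤ b) {X : ℂ × ℂ}
    (hf : DifferentiableAt ℝ f (X.1 ^ b, X.2))
    (hF : fderiv ℝ (fun X : ℂ × ℂ => f (X.1 ^ b, X.2)) X = 0)
    (hA : det₂ (fderiv ℝ f (X.1 ^ b, X.2) (1, 0)) (fderiv ℝ f (X.1 ^ b, X.2) (Complex.I, 0)) ≠ 0) :
    X.1 = 0 ∧ ∀ y : ℂ, fderiv ℝ f (X.1 ^ b, X.2) (0, y) = 0 := by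
  have h1 : HasFDerivAt (fun X : ℂ × ℂ => f (X.1 ^ b, X.2)) _ X :=
    HasFDerivAt.comp (g := f) X hf.hasFDerivAt (hasFDerivAt_branch b X)
  rw [h1.fderiv] at hF
  constructor
  · by_contra hX
    have hne : (b : ℂ) * X.1 ^ (b - 1) ≠ 0 :=
      mul_ne_zero (by exact_mod_cast (by omega)) (pow_ne_zero _ hX)
    have h2 := DFunLike.congr_fun hF (((b : ℂ) * X.1 ^ (b - 1))⁻¹, 0)
    simp only [ContinuousLinearMap.comp_apply, ContinuousLinearMap.prod_apply,
      smul_apply, ContinuousLinearMap.coe_fst', ContinuousLinearMap.coe_snd',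
      smul_eq_mul, mul_inv_cancel₀ hne, zero_apply] at h2
    apply hA
    rw [h2]
    simp [det₂]
  · intro y
    have h2 := DFunLike.congr_fun hF ((0 : ℂ), y)
    simpa using h2

/-- The fibration is constant to first order along the branch locus if its model monomial has a
multiple factor: the critical points of the model contain a germ of a surface, which has to agree
with the germ of the branch locus. -/
lemma eventually_fderiv_eq_zero_of_multiple_factor {f : ℂ × ℂ → ℂ} {a c : ℂ × ℂ → ℂ} {m n b : ℕ}
    (hb : 1 ≤ b) (hm : 2 ≤ m) (hf : ContDiffAt ℝ 1 f 0) (ha : ContDiffAt ℝ 1 a 0)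
    (hc : ContDiffAt ℝ 1 c 0) (ha0 : a 0 = 0)
    (hinj : Function.Injective ((fderiv ℝ a 0).prod (fderiv ℝ c 0)))
    (hfac : ∀ᶠ X in 𝓝 (0 : ℂ × ℂ), a X ^ m * c X ^ n = f (X.1 ^ b, X.2))
    (hA : det₂ (fderiv ℝ f 0 (1, 0)) (fderiv ℝ f 0 (Complex.I, 0)) ≠ 0) :
    ∀ᶠ w in 𝓝 (0 : ℂ), ∀ y : ℂ, fderiv ℝ f (0, w) (0, y) = 0 := by
  set L : ℂ × ℂ →L[ℝ] ℂ × ℂ := (fderiv ℝ a 0).prod (fderiv ℝ c 0) with hL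
  let e : (ℂ × ℂ) ≃L[ℝ] ℂ × ℂ :=
    (LinearEquiv.ofInjectiveEndo (L : ℂ × ℂ →ₗ[ℝ] ℂ × ℂ) hinj).toContinuousLinearEquiv
  have he : (e : ℂ × ℂ →L[ℝ] ℂ × ℂ) = L := by ext x <;> rfl
  have hθ : HasStrictFDerivAt (fun X => (a X, c X)) (e : ℂ × ℂ →L[ℝ] ℂ × ℂ) 0 := by
    rw [he]
    exact (ha.hasStrictFDerivAt one_ne_zero).prodMk (hc.hasStrictFDerivAt one_ne_zero)
  set g := hθ.localInverse _ _ _ with hg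
  have hgd := hθ.to_localInverse
  have hg0 : g (a 0, c 0) = 0 := hθ.localInverse_apply_image
  have hι : HasStrictFDerivAt (fun s : ℂ => ((0 : ℂ), c 0 + s))
      (ContinuousLinearMap.inr ℝ ℂ ℂ) 0 := by
    refine HasStrictFDerivAt.prodMk (hasStrictFDerivAt_const _ _) ?_
    exact (hasStrictFDerivAt_id (𝕜 := ℝ) (0 : ℂ)).const_add (c 0)
  have hι0 : ((0 : ℂ), c 0 + 0) = (a 0, c 0) := by simp [ha0]
  set γ : ℂ → ℂ × ℂ := fun s => g (0, c 0 + s) with hγ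
  have hγ0 : γ 0 = 0 := by simp only [hγ, hι0, hg0]
  have hγd : HasStrictFDerivAt γ
      ((e.symm : ℂ × ℂ →L[ℝ] ℂ × ℂ).comp (ContinuousLinearMap.inr ℝ ℂ ℂ)) 0 := by
    refine HasStrictFDerivAt.comp (g := g) (f := fun s : ℂ => ((0 : ℂ), c 0 + s)) 0 ?_ hι
    rw [hι0]
    exact hgd
  have hγt : Tendsto γ (𝓝 0) (𝓝 0) := by
    have := hγd.continuousAt.tendsto
    rwa [hγ0] at this
  have hinv : ∀ᶠ s in 𝓝 (0 : ℂ), (a (γ s), c (γ s)) = (0, c 0 + s) := by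
    have h1 : ∀ᶠ y in 𝓝 (a 0, c 0), (a (g y), c (g y)) = y := hθ.eventually_right_inverse
    have h2 : Tendsto (fun s : ℂ => ((0 : ℂ), c 0 + s)) (𝓝 0) (𝓝 (a 0, c 0)) := by
      rw [← hι0]
      exact hι.continuousAt
    exact h2.eventually h1
  have hbr : Tendsto (fun X : ℂ × ℂ => (X.1 ^ b, X.2)) (𝓝 0) (𝓝 0) := by
    have := (hasFDerivAt_branch b 0).continuousAt.tendsto
    simpa [show b ≠ 0 by omega, ← Prod.zero_eq_mk] using this
  have hcrit : ∀ᶠ X in 𝓝 (0 : ℂ × ℂ), a X = 0 →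
      X.1 = 0 ∧ ∀ y : ℂ, fderiv ℝ f (X.1 ^ b, X.2) (0, y) = 0 := by
    have hAev : ∀ᶠ Z in 𝓝 (0 : ℂ × ℂ),
        det₂ (fderiv ℝ f Z (1, 0)) (fderiv ℝ f Z (Complex.I, 0)) ≠ 0 := by
      have hcont : ContinuousAt (fderiv ℝ f) 0 :=
        (hf.fderiv_right (m := 0) le_rfl).continuousAt
      have h1 := hcont.clm_apply (continuousAt_const (y := ((1 : ℂ), (0 : ℂ))))
      have h2 := hcont.clm_apply (continuousAt_const (y := (Complex.I, (0 : ℂ))))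
      exact (h1.det₂ h2).eventually_ne hA
    filter_upwards [hfac.eventually_nhds, ha.eventually (by simp), hc.eventually (by simp),
      hbr.eventually hAev, hbr.eventually (hf.eventually (by simp))] with X h1 h2 h3 h4 h5 haX
    refine eq_zero_of_fderiv_branch_eq_zero hb (h5.differentiableAt one_ne_zero) ?_ h4
    have h6 := hasFDerivAt_monomial m n (h2.differentiableAt one_ne_zero).hasFDerivAt
      (h3.differentiableAt one_ne_zero).hasFDerivAt
    have h7 : (fun X : ℂ × ℂ => f (X.1 ^ b, X.2)) =ᶠ[𝓝 X] fun X => a X ^ m * c X ^ n := by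
      filter_upwards [h1] with Z hZ using hZ.symm
    rw [h7.fderiv_eq, h6.fderiv, haX]
    refine ContinuousLinearMap.ext fun v => ?_
    simp [show m - 1 ≠ 0 by omega, show m ≠ 0 by omega]
  have hγcrit : ∀ᶠ s in 𝓝 (0 : ℂ), (γ s).1 = 0 ∧
      ∀ y : ℂ, fderiv ℝ f (0, (γ s).2) (0, y) = 0 := by
    filter_upwards [hγt.eventually hcrit, hinv] with s h1 h2
    obtain ⟨h3, h4⟩ := h1 (congrArg Prod.fst h2)
    refine ⟨h3, fun y => ?_⟩
    have := h4 y
    rwa [h3, zero_pow (by omega)] at this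
  have hδ : HasStrictFDerivAt (fun s => (γ s).2) ((ContinuousLinearMap.snd ℝ ℂ ℂ).comp
      ((e.symm : ℂ × ℂ →L[ℝ] ℂ × ℂ).comp (ContinuousLinearMap.inr ℝ ℂ ℂ))) 0 :=
    hasStrictFDerivAt_snd.comp (0 : ℂ) hγd
  have hε : (ContinuousLinearMap.fst ℝ ℂ ℂ).comp
      ((e.symm : ℂ × ℂ →L[ℝ] ℂ × ℂ).comp (ContinuousLinearMap.inr ℝ ℂ ℂ)) = 0 := by
    have h1 : HasFDerivAt (fun s => (γ s).1) _ 0 := hasFDerivAt_fst.comp (0 : ℂ) hγd.hasFDerivAt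
    have h2 : (fun s => (γ s).1) =ᶠ[𝓝 0] fun _ => (0 : ℂ) := hγcrit.mono fun s hs => hs.1
    exact h1.unique ((hasFDerivAt_const (0 : ℂ) (0 : ℂ)).congr_of_eventuallyEq h2)
  have hsurj : Function.Surjective ((ContinuousLinearMap.snd ℝ ℂ ℂ).comp
      ((e.symm : ℂ × ℂ →L[ℝ] ℂ × ℂ).comp (ContinuousLinearMap.inr ℝ ℂ ℂ))) := by
    refine (LinearMap.injective_iff_surjective (f := (((ContinuousLinearMap.snd ℝ ℂ ℂ).comp
      ((e.symm : ℂ × ℂ →L[ℝ] ℂ × ℂ).comp (ContinuousLinearMap.inr ℝ ℂ ℂ))) : ℂ →ₗ[ℝ] ℂ))).1 ?_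
    refine (injective_iff_map_eq_zero _).2 fun s hs => ?_
    have h1 := DFunLike.congr_fun hε s
    have h2 : e.symm ((0 : ℂ), s) = 0 := Prod.ext h1 hs
    have h3 := (e.symm.map_eq_zero_iff).1 h2
    exact congrArg Prod.snd h3
  have hmap := hδ.map_nhds_eq_of_surj (LinearMap.range_eq_top.2 hsurj)
  rw [hγ0] at hmap
  change ∀ᶠ w in 𝓝 ((0 : ℂ × ℂ).2), _
  rw [← hmap]
  exact eventually_map.2 (hγcrit.mono fun s hs => hs.2)

/-! ### The sign of a fibration along a branch locus -/

/-- Differentiating the identity `a c = f (u ^ b, w)` twice at a node. -/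
lemma polarization_at_node {f : ℂ × ℂ → ℂ} {a c : ℂ × ℂ → ℂ} {b : ℕ} (hb : 2 ≤ b)
    (hf : ContDiffAt ℝ 2 f 0) (ha : ContDiffAt ℝ 2 a 0) (hc : ContDiffAt ℝ 2 c 0)
    (ha0 : a 0 = 0) (hc0 : c 0 = 0)
    (hfac : ∀ᶠ X in 𝓝 (0 : ℂ × ℂ), a X * c X = f (X.1 ^ b, X.2)) (X Y : ℂ × ℂ) :
    fderiv ℝ a 0 X * fderiv ℝ c 0 Y + fderiv ℝ a 0 Y * fderiv ℝ c 0 X =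
      fderiv ℝ (fderiv ℝ f) 0 (0, X.2) (0, Y.2) +
        ((b : ℝ) * ((b - 1 : ℕ) : ℝ) * 0 ^ (b - 1 - 1)) • fderiv ℝ f 0 (X.1 * Y.1, 0) := by
  have hbr0 : (((0 : ℂ × ℂ).1) ^ b, ((0 : ℂ × ℂ).2)) = (0 : ℂ × ℂ) := by
    simp [show b ≠ 0 by omega, ← Prod.zero_eq_mk]
  have hbr : Tendsto (fun X : ℂ × ℂ => (X.1 ^ b, X.2)) (𝓝 0) (𝓝 0) := by
    have := (hasFDerivAt_branch b 0).continuousAt.tendsto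
    rwa [hbr0] at this
  have hid : (fun Z : ℂ × ℂ => fderiv ℝ f (Z.1 ^ b, Z.2) ((b : ℂ) * Z.1 ^ (b - 1) * Y.1, Y.2))
      =ᶠ[𝓝 0] fun Z => fderiv ℝ a Z Y * c Z + a Z * fderiv ℝ c Z Y := by
    filter_upwards [hfac.eventually_nhds, ha.eventually (by simp), hc.eventually (by simp),
      hbr.eventually (hf.eventually (by simp))] with Z h1 h2 h3 h5
    have h4 : HasFDerivAt (fun X : ℂ × ℂ => f (X.1 ^ b, X.2)) _ Z :=
      HasFDerivAt.comp (g := f) Z (h5.differentiableAt two_ne_zero).hasFDerivAt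
        (hasFDerivAt_branch b Z)
    have h6 := (h2.differentiableAt two_ne_zero).hasFDerivAt.mul
      (h3.differentiableAt two_ne_zero).hasFDerivAt
    have h8 := (h6.congr_of_eventuallyEq (f₁ := fun X : ℂ × ℂ => f (X.1 ^ b, X.2)) (by
      filter_upwards [h1] with Z hZ using hZ.symm)).unique h4
    have h9 := DFunLike.congr_fun h8 Y
    simp at h9
    rw [← h9]
    ring
  have hD : HasFDerivAt (fderiv ℝ f) (fderiv ℝ (fderiv ℝ f) 0) 0 :=
    ((hf.fderiv_right (m := 1) le_rfl).differentiableAt one_ne_zero).hasFDerivAt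
  have hDa : HasFDerivAt (fderiv ℝ a) (fderiv ℝ (fderiv ℝ a) 0) 0 :=
    ((ha.fderiv_right (m := 1) le_rfl).differentiableAt one_ne_zero).hasFDerivAt
  have hDc : HasFDerivAt (fderiv ℝ c) (fderiv ℝ (fderiv ℝ c) 0) 0 :=
    ((hc.fderiv_right (m := 1) le_rfl).differentiableAt one_ne_zero).hasFDerivAt
  have hDg : HasFDerivAt (fun Z : ℂ × ℂ => fderiv ℝ f (Z.1 ^ b, Z.2))
      ((fderiv ℝ (fderiv ℝ f) 0).comp
        (((((b : ℂ) * (0 : ℂ × ℂ).1 ^ (b - 1)) • (ContinuousLinearMap.fst ℝ ℂ ℂ))).prod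
        (ContinuousLinearMap.snd ℝ ℂ ℂ))) 0 := by
    refine HasFDerivAt.comp (g := fderiv ℝ f) (0 : ℂ × ℂ) ?_ (hasFDerivAt_branch b 0)
    rw [hbr0]
    exact hD
  have hv := HasFDerivAt.prodMk ((((hasFDerivAt_fst (𝕜 := ℝ) (p := (0 : ℂ × ℂ))).pow
    (b - 1)).const_mul (b : ℂ)).mul_const Y.1) (hasFDerivAt_const Y.2 (0 : ℂ × ℂ))
  have hl := hDg.clm_apply hv
  have hr := ((hDa.clm_apply (hasFDerivAt_const Y _)).mul
    (hc.differentiableAt two_ne_zero).hasFDerivAt).add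
    ((ha.differentiableAt two_ne_zero).hasFDerivAt.mul (hDc.clm_apply (hasFDerivAt_const Y _)))
  have h := DFunLike.congr_fun (hl.unique (hr.congr_of_eventuallyEq hid)) X
  simp [ha0, hc0, show b ≠ 0 by omega, show b - 1 ≠ 0 by omega, ← Prod.zero_eq_mk] at h
  have e : ((Y.1 * ((b : ℂ) * (((b - 1 : ℕ) : ℂ) * 0 ^ (b - 1 - 1) * X.1)), (0 : ℂ)) : ℂ × ℂ) =
      ((b : ℝ) * ((b - 1 : ℕ) : ℝ) * 0 ^ (b - 1 - 1)) • (X.1 * Y.1, (0 : ℂ)) := by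
    refine Prod.ext ?_ (by simp)
    simp only [Prod.smul_mk, Complex.real_smul]
    push_cast
    ring
  rw [e, map_smul] at h
  linear_combination -h

/-- The second-order model of a node: the signs of `f` in the two coordinate directions agree, as
both are the sign by which the orientation of the complex structure of the node, restricted to
the respective coordinate line, differs from the standard one. -/
lemma eventually_nonneg_of_node {f : ℂ × ℂ → ℂ} {a c : ℂ × ℂ → ℂ} {b : ℕ} (hb : 2 ≤ b)
    (hf : ContDiffAt ℝ 2 f 0) (ha : ContDiffAt ℝ 2 a 0) (hc : ContDiffAt ℝ 2 c 0)
    (ha0 : a 0 = 0) (hc0 : c 0 = 0)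
    (hfac : ∀ᶠ X in 𝓝 (0 : ℂ × ℂ), a X * c X = f (X.1 ^ b, X.2))
    (hfw : ∀ y : ℂ, fderiv ℝ f 0 (0, y) = 0)
    (hdet : 0 < det₄ (fderiv ℝ a 0 (1, 0), fderiv ℝ c 0 (1, 0))
      (fderiv ℝ a 0 (Complex.I, 0), fderiv ℝ c 0 (Complex.I, 0))
      (fderiv ℝ a 0 (0, 1), fderiv ℝ c 0 (0, 1))
      (fderiv ℝ a 0 (0, Complex.I), fderiv ℝ c 0 (0, Complex.I))) :
    ∀ᶠ w in 𝓝 (0 : ℂ), 0 ≤ det₂ (fderiv ℝ f 0 (1, 0)) (fderiv ℝ f 0 (Complex.I, 0)) *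
      det₂ (fderiv ℝ f (0, w) (0, 1)) (fderiv ℝ f (0, w) (0, Complex.I)) := by
  have pol := polarization_at_node hb hf ha hc ha0 hc0 hfac
  set β : ℝ := (b : ℝ) * ((b - 1 : ℕ) : ℝ) * 0 ^ (b - 1 - 1) with hβ
  set p₁ := fderiv ℝ a 0 (1, 0)
  set p₂ := fderiv ℝ c 0 (1, 0)
  set q₁ := fderiv ℝ a 0 (Complex.I, 0)
  set q₂ := fderiv ℝ c 0 (Complex.I, 0)
  set r₁ := fderiv ℝ a 0 (0, 1)
  set r₂ := fderiv ℝ c 0 (0, 1)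
  set s₁ := fderiv ℝ a 0 (0, Complex.I)
  set s₂ := fderiv ℝ c 0 (0, Complex.I)
  set D₂ := fderiv ℝ (fderiv ℝ f) 0 with hD₂
  have h00 : ((0 : ℂ), (0 : ℂ)) = 0 := rfl
  have hpr : p₁ * r₂ + p₂ * r₁ = 0 := by
    have := pol (1, 0) (0, 1)
    simp only [mul_zero, h00, map_zero, zero_apply, smul_zero, add_zero] at this
    linear_combination this
  have hps : p₁ * s₂ + p₂ * s₁ = 0 := by
    have := pol (1, 0) (0, Complex.I)
    simp only [mul_zero, h00, map_zero, zero_apply, smul_zero, add_zero] at this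
    linear_combination this
  have hqr : q₁ * r₂ + q₂ * r₁ = 0 := by
    have := pol (Complex.I, 0) (0, 1)
    simp only [mul_zero, h00, map_zero, zero_apply, smul_zero, add_zero] at this
    linear_combination this
  obtain ⟨ρ, τ, hq, hs, hρτ, hp, hr⟩ := complex_lines_of_orthogonal hpr hps hqr hdet
  simp only [Prod.mk.injEq] at hq hs
  simp only at hp hr
  have hp1 : β • fderiv ℝ f 0 (1, 0) = 2 * (p₁ * p₂) := by
    have := pol (1, 0) (1, 0)
    simp only [mul_one, h00, map_zero, zero_add] at this
    linear_combination -this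
  have hp2 : β • fderiv ℝ f 0 (Complex.I, 0) = ρ * (2 * (p₁ * p₂)) := by
    have := pol (1, 0) (Complex.I, 0)
    simp only [one_mul, h00, map_zero, zero_add] at this
    linear_combination -this + p₁ * hq.2 + p₂ * hq.1
  have hdA : β ^ 2 * det₂ (fderiv ℝ f 0 (1, 0)) (fderiv ℝ f 0 (Complex.I, 0)) =
      Complex.normSq (2 * (p₁ * p₂)) * ρ.im := by
    rw [← det₂_smul_smul, hp1, hp2, det₂_mul_self]
  have hD : HasFDerivAt (fderiv ℝ f) D₂ 0 :=
    ((hf.fderiv_right (m := 1) le_rfl).differentiableAt one_ne_zero).hasFDerivAt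
  have hx : ∀ y : ℂ, HasFDerivAt (fun w : ℂ => fderiv ℝ f (0, w) (0, y))
      ((D₂.flip (0, y)).comp (ContinuousLinearMap.inr ℝ ℂ ℂ)) 0 := fun y =>
    (HasFDerivAt.clm_apply hD (hasFDerivAt_const ((0 : ℂ), y) (0 : ℂ × ℂ))).comp
      (g := fun Z : ℂ × ℂ => fderiv ℝ f Z (0, y)) (0 : ℂ)
      (ContinuousLinearMap.inr ℝ ℂ ℂ).hasFDerivAt |>.congr_fderiv (by
        refine ContinuousLinearMap.ext fun w => ?_
        simp)
  -- `N` is the derivative of `w ↦ D_w f (0, w) 1`, while `D_w f (0, w) i` is `τ` times this up to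
  -- terms of higher order.
  have hN : ∀ w : ℂ, D₂ (0, w) (0, 1) = 2 * (r₁ * r₂) * ((w.re : ℂ) + w.im * τ) := by
    intro w
    have := pol (0, w) (0, 1)
    have hw : ((0 : ℂ), w) = w.re • ((0 : ℂ), (1 : ℂ)) + w.im • ((0 : ℂ), Complex.I) := by
      refine Prod.ext (by simp) ?_
      simp
    simp only [mul_zero, h00, map_zero, smul_zero, add_zero] at this
    rw [← this]
    rw [hw, map_add, map_add, map_smul, map_smul, map_smul, map_smul]
    simp only [Complex.real_smul]
    change (w.re * r₁ + w.im * s₁) * r₂ + r₁ * (w.re * r₂ + w.im * s₂) = _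
    rw [hs.1, hs.2]
    ring
  have hN' : ∀ w : ℂ, D₂ (0, w) (0, Complex.I) = τ * D₂ (0, w) (0, 1) := by
    intro w
    have h1 := pol (0, w) (0, 1)
    have h2 := pol (0, w) (0, Complex.I)
    simp only [mul_zero, h00, map_zero, smul_zero, add_zero] at h1 h2
    rw [← h1, ← h2]
    change fderiv ℝ a 0 (0, w) * s₂ + s₁ * fderiv ℝ c 0 (0, w) =
      τ * (fderiv ℝ a 0 (0, w) * r₂ + r₁ * fderiv ℝ c 0 (0, w))
    rw [hs.1, hs.2]
    ring
  have hτ : τ.im ≠ 0 := fun h => by simp [h] at hρτ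
  have hρ : ρ.im ≠ 0 := fun h => by simp [h] at hρτ
  set N : ℂ →L[ℝ] ℂ := (D₂.flip (0, 1)).comp (ContinuousLinearMap.inr ℝ ℂ ℂ) with hNdef
  have hNinj : Function.Injective N := by
    refine (injective_iff_map_eq_zero N).2 fun w hw => ?_
    have h1 : D₂ (0, w) (0, 1) = 0 := hw
    rw [hN, mul_eq_zero] at h1
    have h2 := h1.resolve_left (mul_ne_zero two_ne_zero hr)
    have h3 := congrArg Complex.im h2
    have h4 := congrArg Complex.re h2
    simp [hτ] at h3
    simp [h3] at h4
    exact Complex.ext h4 h3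
  obtain ⟨K, hK, hNK⟩ := LinearMap.exists_antilipschitzWith (N : ℂ →ₗ[ℝ] ℂ)
    (LinearMap.ker_eq_bot.2 hNinj)
  have hKpos : (0 : ℝ) < K := hK
  have hlow : ∀ w : ℂ, ‖w‖ ≤ K * ‖N w‖ := fun w => by
    simpa using hNK.le_mul_dist w 0
  have hx1 : ∀ᶠ w in 𝓝 (0 : ℂ), ‖w‖ ≤ 2 * K * ‖fderiv ℝ f (0, w) (0, 1)‖ := by
    have h1 := (hx 1).isLittleO.def (show (0 : ℝ) < (2 * (K : ℝ))⁻¹ by positivity)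
    filter_upwards [h1] with w hw
    rw [h00, hfw, sub_zero, sub_zero] at hw
    have h2 := hlow w
    have h3 : ‖N w‖ ≤ ‖fderiv ℝ f (0, w) (0, 1)‖ + (2 * K : ℝ)⁻¹ * ‖w‖ := by
      have := norm_sub_le (fderiv ℝ f (0, w) (0, 1)) (fderiv ℝ f (0, w) (0, 1) - N w)
      rw [sub_sub_cancel] at this
      exact this.trans (by gcongr)
    have h4 : K * ‖N w‖ ≤ K * ‖fderiv ℝ f (0, w) (0, 1)‖ + ‖w‖ / 2 := by
      calc K * ‖N w‖ ≤ K * (‖fderiv ℝ f (0, w) (0, 1)‖ + (2 * K : ℝ)⁻¹ * ‖w‖) := by gcongr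
        _ = _ := by field_simp
    linarith
  have hx2 : ∀ᶠ w in 𝓝 (0 : ℂ), ‖fderiv ℝ f (0, w) (0, Complex.I) -
      τ * fderiv ℝ f (0, w) (0, 1)‖ ≤ |τ.im| * (2 * (K : ℝ))⁻¹ * ‖w‖ := by
    have h1 : HasFDerivAt (fun w : ℂ => fderiv ℝ f (0, w) (0, Complex.I) -
        τ * fderiv ℝ f (0, w) (0, 1)) (0 : ℂ →L[ℝ] ℂ) 0 :=
      ((hx Complex.I).sub ((hx 1).const_mul τ)).congr_fderiv (by
        refine ContinuousLinearMap.ext fun w => ?_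
        simp [hN'])
    have h2 := h1.isLittleO.def (show (0 : ℝ) < |τ.im| * (2 * (K : ℝ))⁻¹ by positivity)
    filter_upwards [h2] with w hw
    simpa [h00, hfw] using hw
  filter_upwards [hx1, hx2] with w h1 h2
  set x := fderiv ℝ f (0, w) (0, 1)
  set y := fderiv ℝ f (0, w) (0, Complex.I)
  have h3 : ‖y - τ * x‖ ≤ |τ.im| * ‖x‖ := by
    refine h2.trans ?_
    calc |τ.im| * (2 * K : ℝ)⁻¹ * ‖w‖ ≤ |τ.im| * (2 * K : ℝ)⁻¹ * (2 * K * ‖x‖) := by gcongr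
      _ = |τ.im| * ‖x‖ := by field_simp
  have h4 : det₂ x y = Complex.normSq x * τ.im + det₂ x (y - τ * x) := by
    rw [← det₂_mul_self, ← det₂_add_right]; congr 1; ring
  have h5 : 0 ≤ τ.im * det₂ x y := by
    have h6 := (abs_det₂_le x (y - τ * x)).trans (mul_le_mul_of_nonneg_left h3 (norm_nonneg _))
    have h7 : |τ.im * det₂ x (y - τ * x)| ≤ τ.im ^ 2 * Complex.normSq x := by
      rw [abs_mul, Complex.normSq_eq_norm_sq, ← sq_abs τ.im]
      calc |τ.im| * |det₂ x (y - τ * x)| ≤ |τ.im| * (‖x‖ * (|τ.im| * ‖x‖)) := by gcongr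
        _ = _ := by ring
    have h8 := (abs_le.1 h7).1
    rw [h4]
    nlinarith
  have hβ0 : β ≠ 0 := by
    intro h
    rw [h] at hp1
    simp at hp1
    exact hp (by simpa using hp1)
  have h9 : 0 ≤ ρ.im * det₂ x y := by
    have : 0 ≤ (ρ.im * τ.im) * (τ.im * det₂ x y) := mul_nonneg hρτ.le h5
    have h10 : 0 < τ.im ^ 2 := by positivity
    refine nonneg_of_mul_nonneg_right (a := τ.im ^ 2) ?_ h10
    linarith
  refine nonneg_of_mul_nonneg_right (a := β ^ 2) ?_ (by positivity)
  rw [← mul_assoc, hdA, mul_assoc]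
  exact mul_nonneg (Complex.normSq_nonneg _) h9

/-- The sign of a fibration along the branch locus near a vertical tangency. -/
theorem eventually_nonneg_of_monomial {f : ℂ × ℂ → ℂ} {θ : ℂ × ℂ → ℂ × ℂ} {m n b : ℕ}
    (hb : 2 ≤ b) (hmn : 1 ≤ m + n) (hf : ContDiffAt ℝ 2 f 0) (hθ : ContDiffAt ℝ 2 θ 0)
    (hfac : ∀ᶠ X in 𝓝 (0 : ℂ × ℂ), (θ X).1 ^ m * (θ X).2 ^ n = f (X.1 ^ b, X.2))
    (hfw : ∀ y : ℂ, fderiv ℝ f 0 (0, y) = 0)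
    (hA : det₂ (fderiv ℝ f 0 (1, 0)) (fderiv ℝ f 0 (Complex.I, 0)) ≠ 0)
    (hdet : 0 < det₄ (fderiv ℝ θ 0 (1, 0)) (fderiv ℝ θ 0 (Complex.I, 0))
      (fderiv ℝ θ 0 (0, 1)) (fderiv ℝ θ 0 (0, Complex.I))) :
    ∀ᶠ w in 𝓝 (0 : ℂ), 0 ≤ det₂ (fderiv ℝ f 0 (1, 0)) (fderiv ℝ f 0 (Complex.I, 0)) *
      det₂ (fderiv ℝ f (0, w) (0, 1)) (fderiv ℝ f (0, w) (0, Complex.I)) := by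
  set a : ℂ × ℂ → ℂ := fun X => (θ X).1 with ha_def
  set c : ℂ × ℂ → ℂ := fun X => (θ X).2 with hc_def
  have ha : ContDiffAt ℝ 2 a 0 := hθ.fst
  have hc : ContDiffAt ℝ 2 c 0 := hθ.snd
  have had := (ha.differentiableAt two_ne_zero).hasFDerivAt
  have hcd := (hc.differentiableAt two_ne_zero).hasFDerivAt
  have hθd : fderiv ℝ θ 0 = (fderiv ℝ a 0).prod (fderiv ℝ c 0) := (had.prodMk hcd).fderiv
  have hinj := injective_of_det₄_ne_zero _ hdet.ne'
  have hsurj : Function.Surjective (fderiv ℝ θ 0) :=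
    LinearMap.injective_iff_surjective (f := (fderiv ℝ θ 0 : ℂ × ℂ →ₗ[ℝ] ℂ × ℂ)).1 hinj
  have hbr0 : (((0 : ℂ × ℂ).1) ^ b, ((0 : ℂ × ℂ).2)) = (0 : ℂ × ℂ) := by
    simp [show b ≠ 0 by omega, ← Prod.zero_eq_mk]
  have hFd : HasFDerivAt (fun X : ℂ × ℂ => f (X.1 ^ b, X.2)) (0 : ℂ × ℂ →L[ℝ] ℂ) 0 := by
    have hf' : HasFDerivAt f (fderiv ℝ f 0) (((0 : ℂ × ℂ).1) ^ b, ((0 : ℂ × ℂ).2)) := by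
      rw [hbr0]
      exact (hf.differentiableAt two_ne_zero).hasFDerivAt
    have hF := hf'.comp (0 : ℂ × ℂ) (hasFDerivAt_branch b 0)
    refine hF.congr_fderiv ?_
    refine ContinuousLinearMap.ext fun v => ?_
    simp [show b - 1 ≠ 0 by omega, hfw]
  have hmono := (hasFDerivAt_monomial m n had hcd).unique (hFd.congr_of_eventuallyEq hfac)
  have hza : (m : ℂ) * a 0 ^ (m - 1) * c 0 ^ n = 0 := by
    obtain ⟨v, hv⟩ := hsurj (1, 0)
    have := DFunLike.congr_fun hmono v
    rw [hθd] at hv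
    simp only [ContinuousLinearMap.prod_apply, Prod.mk.injEq] at hv
    simpa [hv.1, hv.2] using this
  have hzc : (n : ℂ) * a 0 ^ m * c 0 ^ (n - 1) = 0 := by
    obtain ⟨v, hv⟩ := hsurj (0, 1)
    have := DFunLike.congr_fun hmono v
    rw [hθd] at hv
    simp only [ContinuousLinearMap.prod_apply, Prod.mk.injEq] at hv
    simpa [hv.1, hv.2] using this
  have finish : (∀ᶠ w in 𝓝 (0 : ℂ), ∀ y : ℂ, fderiv ℝ f (0, w) (0, y) = 0) →
      ∀ᶠ w in 𝓝 (0 : ℂ), 0 ≤ det₂ (fderiv ℝ f 0 (1, 0)) (fderiv ℝ f 0 (Complex.I, 0)) *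
        det₂ (fderiv ℝ f (0, w) (0, 1)) (fderiv ℝ f (0, w) (0, Complex.I)) := fun h =>
    h.mono fun w hw => by rw [hw, hw]; simp [det₂]
  have one_le : (1 : WithTop ℕ∞) ≤ 2 := one_le_two
  by_cases h1 : 2 ≤ m ∧ a 0 = 0
  · rw [hθd] at hinj
    exact finish (eventually_fderiv_eq_zero_of_multiple_factor (by omega) h1.1 (hf.of_le one_le)
      (ha.of_le one_le) (hc.of_le one_le) h1.2 hinj hfac hA)
  by_cases h2 : 2 ≤ n ∧ c 0 = 0
  · refine finish (eventually_fderiv_eq_zero_of_multiple_factor (n := m) (b := b) (by omega) h2.1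
      (hf.of_le one_le) (hc.of_le one_le) (ha.of_le one_le) h2.2 ?_
      (hfac.mono fun X hX => by rw [← hX, mul_comm]) hA)
    rw [hθd] at hinj
    exact fun v w hvw => hinj (Prod.ext (congrArg Prod.snd hvw) (congrArg Prod.fst hvw))
  obtain ⟨rfl, rfl, ha0, hc0⟩ : m = 1 ∧ n = 1 ∧ a 0 = 0 ∧ c 0 = 0 := by
    by_cases ha0 : a 0 = 0 <;> by_cases hc0 : c 0 = 0
    · have hm2 : ¬ 2 ≤ m := fun h => h1 ⟨h, ha0⟩
      have hn2 : ¬ 2 ≤ n := fun h => h2 ⟨h, hc0⟩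
      obtain rfl | rfl : m = 0 ∨ m = 1 := by omega
      · obtain rfl : n = 1 := by omega
        simp at hzc
      · obtain rfl | rfl : n = 0 ∨ n = 1 := by omega
        · simp at hza
        · exact ⟨rfl, rfl, ha0, hc0⟩
    · have hm2 : ¬ 2 ≤ m := fun h => h1 ⟨h, ha0⟩
      obtain rfl | rfl : m = 0 ∨ m = 1 := by omega
      · simp [hc0] at hzc; omega
      · simp [hc0] at hza
    · have hn2 : ¬ 2 ≤ n := fun h => h2 ⟨h, hc0⟩
      obtain rfl | rfl : n = 0 ∨ n = 1 := by omega
      · simp [ha0] at hza; omega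
      · simp [ha0] at hzc
    · simp [ha0, hc0] at hza hzc; omega
  rw [hθd] at hdet
  exact eventually_nonneg_of_node hb hf ha hc ha0 hc0 (hfac.mono fun X hX => by simpa using hX)
    hfw hdet

/-! ### Orientations and determinants -/

/-- The real basis `(1,0), (i,0), (0,1), (0,i)` of `ℂ²`. -/
noncomputable def complexBasis₂ : Module.Basis (Fin 4) ℝ (ℂ × ℂ) :=
  (Complex.basisOneI.prod Complex.basisOneI).reindex (finSumFinEquiv : Fin 2 ⊕ Fin 2 ≃ Fin 4)

lemma complexBasis₂_det (v : Fin 4 → ℂ × ℂ) :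
    complexBasis₂.det v = det₄ (v 0) (v 1) (v 2) (v 3) := by
  rw [Module.Basis.det_apply, det₄]
  congr 1
  ext i j
  rw [Module.Basis.toMatrix_apply]
  have h0 : (finSumFinEquiv : Fin 2 ⊕ Fin 2 ≃ Fin 4).symm 0 = Sum.inl 0 := rfl
  have h1 : (finSumFinEquiv : Fin 2 ⊕ Fin 2 ≃ Fin 4).symm 1 = Sum.inl 1 := rfl
  have h2 : (finSumFinEquiv : Fin 2 ⊕ Fin 2 ≃ Fin 4).symm 2 = Sum.inr 0 := rfl
  have h3 : (finSumFinEquiv : Fin 2 ⊕ Fin 2 ≃ Fin 4).symm 3 = Sum.inr 1 := rfl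
  fin_cases i <;> fin_cases j <;>
    simp [complexBasis₂, h0, h1, h2, h3]

lemma basisOneI_det (x y : ℂ) : Complex.basisOneI.det ![x, y] = det₂ x y := by
  rw [Module.Basis.det_apply, Matrix.det_fin_two]
  simp [Module.Basis.toMatrix_apply, det₂]
  ring

section Orientation

variable {n : ℕ} {V W U : Type*} [AddCommGroup V] [Module ℝ V] [AddCommGroup W] [Module ℝ W]
  [AddCommGroup U] [Module ℝ U]

lemma IsOrientedIso.comp {oV : Orientation ℝ V (Fin n)} {oW : Orientation ℝ W (Fin n)}
    {oU : Orientation ℝ U (Fin n)} {L : V → W} {L' : W → U} (h' : IsOrientedIso oW oU L')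
    (h : IsOrientedIso oV oW L) : IsOrientedIso oV oU (L' ∘ L) := by
  obtain ⟨e, he, rfl⟩ := h
  obtain ⟨e', he', rfl⟩ := h'
  refine ⟨e.trans e', fun v => by simp [he, he'], ?_⟩
  induction oV using Module.Ray.ind with
  | h v hv => rfl

lemma isPositiveFrame_of_det_pos (b : Module.Basis (Fin n) ℝ W) {o : Orientation ℝ V (Fin n)}
    {L : V → W} (hL : IsOrientedIso o b.orientation L) {v : Fin n → V}
    (h : 0 < b.det (L ∘ v)) : IsPositiveFrame o v := by
  obtain ⟨e, he, ho⟩ := hL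
  have hunit : IsUnit (b.det (L ∘ v)) := h.ne'.isUnit
  obtain ⟨hli, hsp⟩ := (b.is_basis_iff_det).2 hunit
  let b' : Module.Basis (Fin n) ℝ W := Module.Basis.mk hli hsp.ge
  have hb' : (b' : Fin n → W) = L ∘ v := Module.Basis.coe_mk _ _
  refine ⟨b'.map e.symm, fun i => ?_, ?_⟩
  · rw [Module.Basis.map_apply, hb', Function.comp_apply, ← he, e.symm_apply_apply]
  · rw [Module.Basis.orientation_map]
    have : b'.orientation = b.orientation := by
      rw [eq_comm, b.orientation_eq_iff_det_pos, hb']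
      exact h
    rw [this, ← ho, ← Orientation.map_symm, Equiv.symm_apply_apply]

lemma det_pos_of_isOrientedIso (b : Module.Basis (Fin n) ℝ W) {o : Orientation ℝ V (Fin n)}
    {L L' : V → W} (hL : IsOrientedIso o b.orientation L) (hL' : IsOrientedIso o b.orientation L')
    {E : W → V} (hE : ∀ w, L (E w) = w) : 0 < b.det (fun i => L' (E (b i))) := by
  obtain ⟨e, he, ho⟩ := hL
  obtain ⟨e', he', ho'⟩ := hL'
  have h1 : ∀ w, E w = e.symm w := fun w => by
    rw [LinearEquiv.eq_symm_apply, he, hE]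
  have h2 : (b.map (e.symm.trans e')).orientation = b.orientation := by
    rw [Module.Basis.orientation_map]
    nth_rewrite 2 [← ho']
    have h3 : Orientation.map (Fin n) e.symm b.orientation = o := by
      rw [← ho, ← Orientation.map_symm, Equiv.symm_apply_apply]
    rw [← h3]
    induction b.orientation using Module.Ray.ind with
    | h v hv => rfl
  rw [eq_comm, b.orientation_eq_iff_det_pos] at h2
  have h4 : (fun i => L' (E (b i))) = b.map (e.symm.trans e') := by
    funext i
    simp [h1, he']
  rwa [h4]

/-- On an oriented plane, a form that is positive on positive frames vanishes on no basis. -/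
lemma apply_basis_ne_zero_of_positive [TopologicalSpace V] (o : Orientation ℝ V (Fin 2))
    (η : V [⋀^Fin 2]→L[ℝ] ℝ) (hη : ∀ v, IsPositiveFrame o v → 0 < η v)
    (b : Module.Basis (Fin 2) ℝ V) : η b ≠ 0 := by
  intro h0
  have hneg := b.orientation_neg_single 0
  rcases b.orientation_eq_or_eq_neg o with h | h
  · exact (hη b ⟨b, fun i => rfl, h.symm⟩).ne' h0
  · have h1 := hη _ ⟨_, fun i => rfl, hneg.trans h.symm⟩
    have h2 : (b.unitsSMul (Function.update 1 0 (-1)) : Fin 2 → V) =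
        Function.update b 0 ((-1 : ℝ) • b 0) := by
      funext i
      rw [Module.Basis.unitsSMul_apply]
      by_cases hi : i = 0
      · subst hi; simp
      · simp [hi]
    rw [h2, ContinuousAlternatingMap.map_update_smul, Function.update_eq_self, h0] at h1
    simp at h1

end Orientation

/-! ### Partial diffeomorphisms, and monomial local forms under blow-ups -/

section PartialDiffeomorph

variable {EX HX EY HY : Type*} [NormedAddCommGroup EX] [NormedSpace ℝ EX] [TopologicalSpace HX]
  [NormedAddCommGroup EY] [NormedSpace ℝ EY] [TopologicalSpace HY]
  {I : ModelWithCorners ℝ EX HX} {J : ModelWithCorners ℝ EY HY} {X Y : Type*}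
  [TopologicalSpace X] [ChartedSpace HX X] [TopologicalSpace Y] [ChartedSpace HY Y]
  (φ : PartialDiffeomorph I J X Y ∞)

namespace PartialDiffeomorph

lemma contMDiffAt' {x : X} (hx : x ∈ φ.source) : ContMDiffAt I J ∞ φ x :=
  φ.contMDiffOn.contMDiffAt (φ.open_source.mem_nhds hx)

lemma contMDiffAt_symm {z : Y} (hz : z ∈ φ.target) : ContMDiffAt J I ∞ φ.symm z :=
  φ.symm.contMDiffOn.contMDiffAt (φ.open_target.mem_nhds hz)

lemma symm_mem_source {z : Y} (hz : z ∈ φ.target) : φ.symm z ∈ φ.source :=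
  φ.toPartialEquiv.map_target hz

lemma mem_target {x : X} (hx : x ∈ φ.source) : φ x ∈ φ.target :=
  φ.toPartialEquiv.map_source hx

lemma apply_symm {z : Y} (hz : z ∈ φ.target) : φ (φ.symm z) = z :=
  φ.toPartialEquiv.right_inv hz

lemma symm_apply {x : X} (hx : x ∈ φ.source) : φ.symm (φ x) = x :=
  φ.toPartialEquiv.left_inv hx

lemma source_mem_nhds {x : X} (hx : x ∈ φ.source) : φ.source ∈ 𝓝 x := φ.open_source.mem_nhds hx

lemma target_mem_nhds {z : Y} (hz : z ∈ φ.target) : φ.target ∈ 𝓝 z := φ.open_target.mem_nhds hz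

lemma openPartialHomeomorph_mdifferentiable : φ.toOpenPartialHomeomorph.MDifferentiable I J :=
  ⟨φ.mdifferentiableOn (by simp), φ.symm.mdifferentiableOn (by simp)⟩

lemma mfderiv_mfderiv_symm {z : Y} (hz : z ∈ φ.target) (v : TangentSpace J z) :
    mfderiv I J φ (φ.symm z) (mfderiv J I φ.symm z v) = v :=
  DFunLike.congr_fun (φ.openPartialHomeomorph_mdifferentiable.comp_symm_deriv hz) v

lemma map_nhds_eq {x : X} (hx : x ∈ φ.source) : map φ (𝓝 x) = 𝓝 (φ x) :=
  φ.toOpenPartialHomeomorph.map_nhds_eq hx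

/-- The restriction of a partial diffeomorphism to an open subset of its source. -/
def restrict (U : Set X) (hU : IsOpen U) : PartialDiffeomorph I J X Y ∞ where
  toPartialEquiv := φ.toPartialEquiv.restr U
  open_source := φ.open_source.inter hU
  open_target := φ.toOpenPartialHomeomorph.symm.isOpen_inter_preimage hU
  contMDiffOn_toFun := φ.contMDiffOn_toFun.mono inter_subset_left
  contMDiffOn_invFun := φ.contMDiffOn_invFun.mono inter_subset_left

end PartialDiffeomorph

end PartialDiffeomorph

section InverseFunction

variable {EX HX EY HY E F : Type*} [NormedAddCommGroup EX] [NormedSpace ℝ EX] [TopologicalSpace HX]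
  [NormedAddCommGroup EY] [NormedSpace ℝ EY] [TopologicalSpace HY]
  [NormedAddCommGroup E] [NormedSpace ℝ E] [NormedAddCommGroup F] [NormedSpace ℝ F]
  {I : ModelWithCorners ℝ EX HX} {J : ModelWithCorners ℝ EY HY} {X Y : Type*}
  [TopologicalSpace X] [ChartedSpace HX X] [TopologicalSpace Y] [ChartedSpace HY Y]

/-- A smooth map whose derivative at a point is surjective is open at this point. -/
lemma map_nhds_eq_of_mfderiv_surjective [CompleteSpace E] [CompleteSpace F]
    (φ : PartialDiffeomorph I 𝓘(ℝ, E) X E ∞) (ψ : PartialDiffeomorph J 𝓘(ℝ, F) Y F ∞)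
    {σ : X → Y} {x : X} (hx : x ∈ φ.source) (hσx : σ x ∈ ψ.source)
    (hσ : ContMDiffAt I J ∞ σ x) (hsurj : Function.Surjective (mfderiv I J σ x)) :
    map σ (𝓝 x) = 𝓝 (σ x) := by
  obtain ⟨z, hz, rfl⟩ : ∃ z ∈ φ.target, x = φ.symm z :=
    ⟨φ x, φ.mem_target hx, (φ.symm_apply hx).symm⟩
  have hc : ContMDiffAt 𝓘(ℝ, E) I ∞ φ.symm z := φ.contMDiffAt_symm hz
  have hψ : ContMDiffAt J 𝓘(ℝ, F) ∞ ψ (σ (φ.symm z)) := ψ.contMDiffAt' hσx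
  have hσc : ContMDiffAt 𝓘(ℝ, E) J ∞ (σ ∘ φ.symm) z := hσ.comp z hc
  have hg : ContMDiffAt 𝓘(ℝ, E) 𝓘(ℝ, F) ∞ (ψ ∘ (σ ∘ φ.symm)) z := hψ.comp z hσc
  have hg' : HasStrictFDerivAt (ψ ∘ (σ ∘ φ.symm)) (fderiv ℝ (ψ ∘ (σ ∘ φ.symm)) z) z :=
    (contMDiffAt_iff_contDiffAt.1 hg).hasStrictFDerivAt (by simp)
  have hd : (fderiv ℝ (ψ ∘ (σ ∘ φ.symm)) z : E → F) =
      mfderiv J 𝓘(ℝ, F) ψ (σ (φ.symm z)) ∘ mfderiv I J σ (φ.symm z) ∘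
        mfderiv 𝓘(ℝ, E) I φ.symm z := by
    rw [← mfderiv_eq_fderiv, mfderiv_comp z (hψ.mdifferentiableAt (by simp))
      (hσc.mdifferentiableAt (by simp)), mfderiv_comp z (hσ.mdifferentiableAt (by simp))
      (hc.mdifferentiableAt (by simp))]
    rfl
  have hsurj' : Function.Surjective (fderiv ℝ (ψ ∘ (σ ∘ φ.symm)) z) := by
    rw [hd]
    refine Function.Surjective.comp ?_ (hsurj.comp ?_)
    · exact (ψ.openPartialHomeomorph_mdifferentiable).mfderiv_surjective hσx
    · exact (φ.symm.openPartialHomeomorph_mdifferentiable).mfderiv_surjective hz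
  have hmap : map (ψ ∘ (σ ∘ φ.symm)) (𝓝 z) = 𝓝 (ψ (σ (φ.symm z))) :=
    hg'.map_nhds_eq_of_surj (LinearMap.range_eq_top.2 hsurj')
  have h2 : map ψ.symm (map (ψ ∘ (σ ∘ φ.symm)) (𝓝 z)) = map σ (𝓝 (φ.symm z)) := by
    rw [← φ.symm.map_nhds_eq hz, Filter.map_map, Filter.map_map]
    refine Filter.map_congr ?_
    filter_upwards [hσc.continuousAt.preimage_mem_nhds (ψ.source_mem_nhds hσx)] with y hy
    exact ψ.symm_apply hy
  rw [← h2, hmap]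
  have := ψ.symm.map_nhds_eq (ψ.mem_target hσx)
  rwa [ψ.symm_apply hσx] at this

end InverseFunction

/-- At the point `x`, the fibration is a non-constant monomial `z ^ m w ^ n` in complex coordinates
`h = (z, w)` on `X`, not necessarily centered at `x`, and `t` on the sphere, both compatible with
the orientations. For `h` it suffices to ask that the derivative at `x` is an oriented
isomorphism. -/
def IsMonomialAt (oS : ManifoldOrientation 2 S2) (X : FourManifoldOverS2) (x : X) : Prop :=
  ∃ (h : X → ℂ × ℂ) (t : PartialDiffeomorph (𝓡 2) 𝓘(ℝ, ℂ) S2 ℂ ∞) (m n : ℕ),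
    IsOrientedChart₁ oS t ∧ 1 ≤ m + n ∧ X.proj x ∈ t.source ∧
    ContMDiffAt (𝓡 4) 𝓘(ℝ, ℂ × ℂ) ∞ h x ∧
    IsOrientedIso (X.orientation.at' x) complexOrientation₂ (mfderiv (𝓡 4) 𝓘(ℝ, ℂ × ℂ) h x) ∧
    ∀ᶠ y in 𝓝 x, t (X.proj y) = (h y).1 ^ m * (h y).2 ^ n

lemma IsSLF.isMonomialAt {oS : ManifoldOrientation 2 S2} {M : FourManifoldOverS2}
    (hM : IsSLF oS M) {x : M} (hx : x ∈ critSet (m := 4) (n := 2) M.proj) :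
    IsMonomialAt oS M x := by
  obtain ⟨φ, t, hφ, ht, hxφ, hmaps, hzw⟩ := hM.lefschetz x hx
  refine ⟨φ, t, 1, 1, ht, by norm_num, hmaps hxφ, φ.contMDiffAt' hxφ, hφ x hxφ, ?_⟩
  filter_upwards [φ.source_mem_nhds hxφ] with y hy
  simpa using hzw y hy

lemma IsOrientedIso.surjective {n : ℕ} {V W : Type*} [AddCommGroup V] [Module ℝ V]
    [AddCommGroup W] [Module ℝ W] {oV : Orientation ℝ V (Fin n)} {oW : Orientation ℝ W (Fin n)}
    {L : V → W} (h : IsOrientedIso oV oW L) : Function.Surjective L := by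
  obtain ⟨e, he, -⟩ := h
  intro w
  exact ⟨e.symm w, by rw [← he]; simp⟩

/-- Monomial local forms persist under adapted blow-ups: in the two coordinate patches of the
blow-up, `z ^ m w ^ n` becomes `a ^ (m + n) b ^ n` and `a ^ m b ^ (m + n)`. -/
lemma FiberedBlowUpStep.isMonomialAt {oS : ManifoldOrientation 2 S2}
    {X' X : FourManifoldOverS2.{u}} (hstep : FiberedBlowUpStep oS X' X)
    (hX : ∀ x ∈ critSet (m := 4) (n := 2) X.proj, IsMonomialAt oS X x) :
    ∀ x ∈ critSet (m := 4) (n := 2) X'.proj, IsMonomialAt oS X' x := by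
  obtain ⟨σ, P, φ, hσ, ⟨t, m, n, ht, hmn, hmaps, hmono⟩, hproj⟩ := hstep
  obtain ⟨ψ₁, ψ₂, hψ₁, hψ₂, hsource, -, -, hσ₁, hσ₂, -, -⟩ := hσ.blowUp
  intro x hx
  have hsub₁ : ∀ y ∈ ψ₁.source, σ y ∈ φ.source := fun y hy => by
    have : y ∈ σ ⁻¹' φ.source := by rw [← hsource]; exact Or.inl hy
    exact this
  have hsub₂ : ∀ y ∈ ψ₂.source, σ y ∈ φ.source := fun y hy => by
    have : y ∈ σ ⁻¹' φ.source := by rw [← hsource]; exact Or.inr hy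
    exact this
  by_cases hxφ : σ x ∈ φ.source
  · have hx' : x ∈ ψ₁.source ∪ ψ₂.source := by rw [hsource]; exact hxφ
    rcases hx' with h1 | h2
    · refine ⟨ψ₁, t, m + n, n, ht, by omega, ?_, ψ₁.contMDiffAt' h1, hψ₁ x h1, ?_⟩
      · rw [hproj]; exact hmaps hxφ
      · filter_upwards [ψ₁.source_mem_nhds h1] with y hy
        rw [hproj, hmono _ (hsub₁ y hy), hσ₁ y hy]
        ring
    · refine ⟨ψ₂, t, m, m + n, ht, by omega, ?_, ψ₂.contMDiffAt' h2, hψ₂ x h2, ?_⟩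
      · rw [hproj]; exact hmaps hxφ
      · filter_upwards [ψ₂.source_mem_nhds h2] with y hy
        rw [hproj, hmono _ (hsub₂ y hy), hσ₂ y hy]
        ring
  · have hxP : σ x ≠ P := fun h => hxφ (h ▸ hσ.mem_source)
    have hiso := hσ.oriented x hxP
    have hσd : MDifferentiableAt (𝓡 4) (𝓡 4) σ x := (hσ.contMDiff x).mdifferentiableAt (by simp)
    have hfun : X'.proj = X.proj ∘ σ := funext hproj
    have hcrit : σ x ∈ critSet (m := 4) (n := 2) X.proj := by
      intro hs
      apply hx
      rw [hfun, mfderiv_comp x ((X.contMDiff_proj (σ x)).mdifferentiableAt (by simp)) hσd]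
      exact hs.comp hiso.surjective
    obtain ⟨h, t', m', n', ht', hmn', hsrc, hh, hhiso, hev⟩ := hX _ hcrit
    refine ⟨h ∘ σ, t', m', n', ht', hmn', ?_, hh.comp x (hσ.contMDiff x), ?_, ?_⟩
    · rw [hproj]; exact hsrc
    · rw [mfderiv_comp x (hh.mdifferentiableAt (by simp)) hσd]
      exact hhiso.comp hiso
    · filter_upwards [(hσ.contMDiff x).continuousAt.eventually hev] with y hy
      rw [hproj]
      exact hy

lemma IsFiberedBlowUp.isMonomialAt {oS : ManifoldOrientation 2 S2}
    {M' M : FourManifoldOverS2.{u}} (h : IsFiberedBlowUp oS M' M) (hM : IsSLF oS M) :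
    ∀ x ∈ critSet (m := 4) (n := 2) M'.proj, IsMonomialAt oS M' x := by
  induction h using Relation.ReflTransGen.head_induction_on with
  | refl => exact fun x hx => hM.isMonomialAt hx
  | head h1 _ ih => exact h1.isMonomialAt ih

/-! ### Compactness of blow-ups -/

/-- Blow-ups are proper; in particular they preserve compactness. -/
lemma IsBlowUpInChart.compactSpace {X' X : FourManifoldOverS2} {σ : X' → X} {P : X}
    {φ : PartialDiffeomorph (𝓡 4) 𝓘(ℝ, ℂ × ℂ) X (ℂ × ℂ) ∞} (hσ : IsBlowUpInChart σ P φ)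
    [CompactSpace X] : CompactSpace X' := by
  refine ⟨isCompact_iff_ultrafilter_le_nhds.2 fun F _ => ?_⟩
  obtain ⟨y, -, hy⟩ := isCompact_iff_ultrafilter_le_nhds.1 (isCompact_univ (X := X))
    (F.map σ) (by simp)
  by_cases hyP : y = P
  · subst hyP
    obtain ⟨ψ₁, ψ₂, -, -, hsource, ht₁, ht₂, hσ₁, hσ₂, h₁₂, htrans⟩ := hσ.blowUp
    obtain ⟨r, hr, hball⟩ := Metric.nhds_basis_closedBall.mem_iff.1
      (φ.target_mem_nhds (φ.mem_target hσ.mem_source))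
    rw [hσ.centered] at hball
    have hK : ∀ (ψ : PartialDiffeomorph (𝓡 4) 𝓘(ℝ, ℂ × ℂ) X' (ℂ × ℂ) ∞) (r₁ r₂ : ℝ),
        Metric.closedBall (0 : ℂ) r₁ ×ˢ Metric.closedBall (0 : ℂ) r₂ ⊆ ψ.target →
        IsCompact (ψ.symm '' Metric.closedBall (0 : ℂ) r₁ ×ˢ Metric.closedBall (0 : ℂ) r₂) :=
      fun ψ r₁ r₂ h =>
        ((isCompact_closedBall _ _).prod (isCompact_closedBall _ _)).image_of_continuousOn
          (ψ.symm.contMDiffOn.continuousOn.mono h)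
    have hK₁ := hK ψ₁ r 1 (by
      rintro ⟨a, b⟩ ⟨ha, hb⟩
      simp only [mem_closedBall_zero_iff] at ha hb
      rw [ht₁]
      refine hball ?_
      simp only [mem_closedBall_zero_iff, Prod.norm_def, norm_mul, sup_le_iff]
      exact ⟨ha, by nlinarith [norm_nonneg a, norm_nonneg b]⟩)
    have hK₂ := hK ψ₂ 1 r (by
      rintro ⟨a, b⟩ ⟨ha, hb⟩
      simp only [mem_closedBall_zero_iff] at ha hb
      rw [ht₂]
      refine hball ?_
      simp only [mem_closedBall_zero_iff, Prod.norm_def, norm_mul, sup_le_iff]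
      exact ⟨by nlinarith [norm_nonneg a, norm_nonneg b], hb⟩)
    have h₂₁ : ∀ x ∈ ψ₂.source, (ψ₂ x).1 ≠ 0 → x ∈ ψ₁.source := by
      intro x hx hne
      have hz : ((ψ₂ x).1 * (ψ₂ x).2, (ψ₂ x).1⁻¹) ∈ ψ₁.target := by
        have := ψ₂.mem_target hx
        rw [ht₂] at this
        rw [ht₁]
        simpa [mul_comm (ψ₂ x).1, mul_assoc, hne] using this
      have hz₁ := ψ₁.symm_mem_source hz
      have hz₂ : ψ₁.symm ((ψ₂ x).1 * (ψ₂ x).2, (ψ₂ x).1⁻¹) ∈ ψ₂.source := by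
        rw [h₁₂ _ hz₁, ψ₁.apply_symm hz]
        simpa using hne
      have heq := htrans _ ⟨hz₁, hz₂⟩
      rw [ψ₁.apply_symm hz] at heq
      have : ψ₁.symm ((ψ₂ x).1 * (ψ₂ x).2, (ψ₂ x).1⁻¹) = x := by
        refine ψ₂.toPartialEquiv.injOn hz₂ hx (heq.trans ?_)
        refine Prod.ext (by simp) ?_
        simp only
        field_simp
      rwa [this] at hz₁
    have hS : σ ⁻¹' (φ.source ∩ φ ⁻¹' Metric.closedBall 0 r) ∈ F := by
      have hc := (φ.contMDiffAt' hσ.mem_source).continuousAt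
      have : φ.source ∩ φ ⁻¹' Metric.closedBall 0 r ∈ 𝓝 y := by
        refine inter_mem (φ.source_mem_nhds hσ.mem_source) (hc.preimage_mem_nhds ?_)
        rw [hσ.centered]
        exact Metric.closedBall_mem_nhds _ hr
      exact hy this
    obtain ⟨x, -, hx⟩ := isCompact_iff_ultrafilter_le_nhds.1 (hK₁.union hK₂) F (by
      refine le_principal_iff.2 (mem_of_superset hS ?_)
      rintro x ⟨hxs, hxr⟩
      have hx' : x ∈ ψ₁.source ∪ ψ₂.source := by rw [hsource]; exact hxs
      simp only [mem_preimage, mem_closedBall_zero_iff, Prod.norm_def, sup_le_iff] at hxr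
      have in₂ : x ∈ ψ₂.source → ‖(ψ₂ x).1‖ ≤ 1 →
          x ∈ ψ₂.symm '' Metric.closedBall (0 : ℂ) 1 ×ˢ Metric.closedBall (0 : ℂ) r := by
        intro h2 h3
        refine ⟨ψ₂ x, ⟨by simpa using h3, ?_⟩, ψ₂.symm_apply h2⟩
        rw [hσ₂ x h2] at hxr
        simpa using hxr.2
      by_cases h1 : x ∈ ψ₁.source
      · by_cases hb : ‖(ψ₁ x).2‖ ≤ 1
        · refine Or.inl ⟨ψ₁ x, ⟨?_, by simpa using hb⟩, ψ₁.symm_apply h1⟩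
          rw [hσ₁ x h1] at hxr
          simpa using hxr.1
        · have hb0 : (ψ₁ x).2 ≠ 0 := fun h => hb (by simp [h])
          have h2 := (h₁₂ x h1).2 hb0
          refine Or.inr (in₂ h2 ?_)
          rw [htrans x ⟨h1, h2⟩]
          simp only [norm_inv]
          exact inv_le_one_of_one_le₀ (not_le.1 hb).le
      · have h2 := hx'.resolve_left h1
        refine Or.inr (in₂ h2 ?_)
        have : (ψ₂ x).1 = 0 := by
          by_contra hne
          exact h1 (h₂₁ x h2 hne)
        simp [this])
    exact ⟨x, mem_univ _, hx⟩
  · obtain ⟨x, hxP, rfl⟩ := hσ.bijOn.surjOn hyP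
    refine ⟨x, mem_univ _, fun U hU => ?_⟩
    obtain ⟨Φ, hΦ, -⟩ := X'.orientation.locally_standard x
    obtain ⟨Ψ, hΨ, -⟩ := X.orientation.locally_standard (σ x)
    have hmap := map_nhds_eq_of_mfderiv_surjective Φ Ψ hΦ hΨ (hσ.contMDiff x)
      (hσ.oriented x hxP).surjective
    have hU' : U ∩ {x | σ x ≠ P} ∈ 𝓝 x :=
      inter_mem hU ((hσ.contMDiff x).continuousAt.eventually_ne hxP)
    rw [← hmap] at hy
    have h1 : σ ⁻¹' (σ '' (U ∩ {x | σ x ≠ P})) ∈ F := hy (image_mem_map hU')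
    refine mem_of_superset h1 ?_
    rintro z ⟨z', ⟨hz'U, hz'P⟩, hzz'⟩
    have hzP : σ z ≠ P := hzz' ▸ hz'P
    rwa [← hσ.bijOn.injOn hz'P hzP hzz']

lemma IsFiberedBlowUp.compactSpace {oS : ManifoldOrientation 2 S2}
    {M' M : FourManifoldOverS2.{u}} (h : IsFiberedBlowUp oS M' M) (hM : IsSLF oS M) :
    CompactSpace M' := by
  induction h using Relation.ReflTransGen.head_induction_on with
  | refl => exact ⟨by simpa using hM.proper.isCompact_preimage (isCompact_univ (X := S2))⟩
  | head h1 _ ih =>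
    obtain ⟨σ, P, φ, hσ, -⟩ := h1
    exact hσ.compactSpace

/-! ### The branch locus of a branched covering -/

/-- The critical points of a branched covering in a coordinate patch `(u, w) ↦ (u ^ b, w)`. -/
lemma mem_critSet_iff_of_branch {X' X : FourManifoldOverS2} {κ : X' → X}
    (hκ : ContMDiff (𝓡 4) (𝓡 4) ∞ κ)
    {φ : PartialDiffeomorph (𝓡 4) 𝓘(ℝ, ℂ × ℂ) X (ℂ × ℂ) ∞}
    {ψ : PartialDiffeomorph (𝓡 4) 𝓘(ℝ, ℂ × ℂ) X' (ℂ × ℂ) ∞} {b : ℕ} (hb : 1 ≤ b)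
    (hmaps : MapsTo κ ψ.source φ.source)
    (hmodel : ∀ y ∈ ψ.source, φ (κ y) = ((ψ y).1 ^ b, (ψ y).2)) {y : X'} (hy : y ∈ ψ.source) :
    y ∈ critSet (m := 4) (n := 4) κ ↔ 2 ≤ b ∧ (ψ y).1 = 0 := by
  have hφ := φ.contMDiffAt' (hmaps hy)
  have hψ := ψ.contMDiffAt' hy
  have hB : MDifferentiableAt 𝓘(ℝ, ℂ × ℂ) 𝓘(ℝ, ℂ × ℂ) (fun X : ℂ × ℂ => (X.1 ^ b, X.2)) (ψ y) :=
    (hasFDerivAt_branch b (ψ y)).differentiableAt.mdifferentiableAt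
  have h1 : φ ∘ κ =ᶠ[𝓝 y] (fun X : ℂ × ℂ => (X.1 ^ b, X.2)) ∘ ψ := by
    filter_upwards [ψ.source_mem_nhds hy] with z hz using hmodel z hz
  have h2 := h1.mfderiv_eq (I := 𝓡 4) (I' := 𝓘(ℝ, ℂ × ℂ))
  rw [mfderiv_comp y (hφ.mdifferentiableAt (by simp)) ((hκ y).mdifferentiableAt (by simp)),
    mfderiv_comp y hB (hψ.mdifferentiableAt (by simp)), mfderiv_eq_fderiv,
    (hasFDerivAt_branch b (ψ y)).fderiv] at h2
  have h3 : ∀ v : TangentSpace (𝓡 4) y,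
      (mfderiv (𝓡 4) 𝓘(ℝ, ℂ × ℂ) φ (κ y) (mfderiv (𝓡 4) (𝓡 4) κ y v) : ℂ × ℂ) =
      ((b : ℂ) * (ψ y).1 ^ (b - 1) * (mfderiv (𝓡 4) 𝓘(ℝ, ℂ × ℂ) ψ y v : ℂ × ℂ).1,
        (mfderiv (𝓡 4) 𝓘(ℝ, ℂ × ℂ) ψ y v : ℂ × ℂ).2) := fun v => DFunLike.congr_fun h2 v
  have hφb := φ.openPartialHomeomorph_mdifferentiable.mfderiv_bijective (hmaps hy)
  have hψb := ψ.openPartialHomeomorph_mdifferentiable.mfderiv_bijective hy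
  have h4 : (2 ≤ b ∧ (ψ y).1 = 0) ↔ (b : ℂ) * (ψ y).1 ^ (b - 1) = 0 := by
    have : b ≠ 0 := by omega
    simp only [mul_eq_zero, Nat.cast_eq_zero, this, false_or, pow_eq_zero_iff']
    constructor
    · rintro ⟨h, h'⟩; exact ⟨h', by omega⟩
    · rintro ⟨h, h'⟩; exact ⟨by omega, h⟩
  rw [h4, critSet, mem_ofPred_eq, not_iff_comm]
  constructor
  · intro hne w
    obtain ⟨v, hv⟩ := hψb.2 (((b : ℂ) * (ψ y).1 ^ (b - 1))⁻¹ *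
      (mfderiv (𝓡 4) 𝓘(ℝ, ℂ × ℂ) φ (κ y) w : ℂ × ℂ).1,
      (mfderiv (𝓡 4) 𝓘(ℝ, ℂ × ℂ) φ (κ y) w : ℂ × ℂ).2)
    refine ⟨v, hφb.1 ?_⟩
    have h5 := h3 v
    have hv1 := congrArg Prod.fst hv
    have hv2 := congrArg Prod.snd hv
    refine Eq.trans h5 (Prod.ext ?_ ?_)
    · refine (congrArg (fun z : ℂ => (b : ℂ) * (ψ y).1 ^ (b - 1) * z) hv1).trans ?_
      exact mul_inv_cancel_left₀ hne _
    · exact hv2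
  · intro hs h0
    obtain ⟨w, hw⟩ := hφb.2 ((1 : ℂ), (0 : ℂ))
    obtain ⟨v, rfl⟩ := hs w
    have h5 := congrArg Prod.fst ((h3 v).symm.trans hw)
    rw [h0] at h5
    simp at h5

/-- Around each point, the branch locus of a branched covering is contained in the coordinate line
`z = 0` of the local model, and empty unless some preimage of the point is a critical point. -/
lemma IsBranchedCovering.eventually_mem_branchLocus {X' X : FourManifoldOverS2} {κ : X' → X}
    (hκ : IsBranchedCovering κ) (P : X) :
    ∃ φ : PartialDiffeomorph (𝓡 4) 𝓘(ℝ, ℂ × ℂ) X (ℂ × ℂ) ∞,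
      IsOrientedChart₂ X.orientation φ ∧ P ∈ φ.source ∧ φ P = 0 ∧
      (∀ Q : X', κ Q = P → ∃ (ψ : PartialDiffeomorph (𝓡 4) 𝓘(ℝ, ℂ × ℂ) X' (ℂ × ℂ) ∞) (b : ℕ),
        IsOrientedChart₂ X'.orientation ψ ∧ Q ∈ ψ.source ∧ ψ Q = 0 ∧ 1 ≤ b ∧
        MapsTo κ ψ.source φ.source ∧ ∀ y ∈ ψ.source, φ (κ y) = ((ψ y).1 ^ b, (ψ y).2)) ∧
      ∀ᶠ x in 𝓝 P, x ∈ branchLocus κ → P ∈ branchLocus κ ∧ (φ x).1 = 0 := by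
  obtain ⟨φ, hφ, hP, hP0, hQ⟩ := hκ.local_model P
  have hQ' : ∀ Q : X', κ Q = P →
      ∃ (ψ : PartialDiffeomorph (𝓡 4) 𝓘(ℝ, ℂ × ℂ) X' (ℂ × ℂ) ∞) (b : ℕ),
        IsOrientedChart₂ X'.orientation ψ ∧ Q ∈ ψ.source ∧ ψ Q = 0 ∧ 1 ≤ b ∧
        MapsTo κ ψ.source φ.source ∧ ∀ y ∈ ψ.source, φ (κ y) = ((ψ y).1 ^ b, (ψ y).2) := by
    intro Q hQP
    obtain ⟨ψ, b, hψ, hQψ, hb, hmaps, hmodel⟩ := hQ Q hQP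
    refine ⟨ψ, b, hψ, hQψ, ?_, hb, hmaps, hmodel⟩
    have h1 := hmodel Q hQψ
    rw [hQP, hP0] at h1
    have h2 := congrArg Prod.fst h1
    have h3 := congrArg Prod.snd h1
    exact Prod.ext (pow_eq_zero_iff (by omega) |>.1 h2.symm) h3.symm
  refine ⟨φ, hφ, hP, hP0, hQ', ?_⟩
  choose ψ b hψ hQψ hQ0 hb hmaps hmodel using hQ'
  have hW : IsOpen (⋃ Q : κ ⁻¹' {P}, (ψ Q Q.2).source) :=
    isOpen_iUnion fun Q => (ψ Q Q.2).open_source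
  have hV : (κ '' (⋃ Q : κ ⁻¹' {P}, (ψ Q Q.2).source)ᶜ)ᶜ ∈ 𝓝 P := by
    refine (hκ.proper.isClosedMap _ hW.isClosed_compl).isOpen_compl.mem_nhds ?_
    rintro ⟨Q, hQW, hQP⟩
    exact hQW (mem_iUnion.2 ⟨⟨Q, hQP⟩, hQψ Q hQP⟩)
  filter_upwards [hV] with x hx hxB
  obtain ⟨y, hy, rfl⟩ := hxB
  have hyW : y ∈ ⋃ Q : κ ⁻¹' {P}, (ψ Q Q.2).source := by
    by_contra h
    exact hx ⟨y, h, rfl⟩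
  obtain ⟨⟨Q, hQP⟩, hyQ⟩ := mem_iUnion.1 hyW
  obtain ⟨hb2, hy0⟩ := (mem_critSet_iff_of_branch hκ.contMDiff (hb Q hQP) (hmaps Q hQP)
    (hmodel Q hQP) hyQ).1 hy
  constructor
  · refine ⟨Q, ?_, hQP⟩
    rw [mem_critSet_iff_of_branch hκ.contMDiff (hb Q hQP) (hmaps Q hQP)
      (hmodel Q hQP) (hQψ Q hQP), hQ0 Q hQP]
    exact ⟨hb2, rfl⟩
  · rw [hmodel Q hQP y hyQ, hy0]
    exact zero_pow (by have := hb Q hQP; omega)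

/-- The local model of a branched covering around a point of the branch locus: the branch locus is
the coordinate line `z = 0`, and some preimage is a branch point of order at least two. -/
lemma IsBranchedCovering.exists_model {X' X : FourManifoldOverS2} {κ : X' → X}
    (hκ : IsBranchedCovering κ) {P : X} (hPB : P ∈ branchLocus κ) :
    ∃ (φ : PartialDiffeomorph (𝓡 4) 𝓘(ℝ, ℂ × ℂ) X (ℂ × ℂ) ∞) (Q : X')
      (ψ : PartialDiffeomorph (𝓡 4) 𝓘(ℝ, ℂ × ℂ) X' (ℂ × ℂ) ∞) (b : ℕ) (r : ℝ),
      IsOrientedChart₂ X.orientation φ ∧ P ∈ φ.source ∧ φ P = 0 ∧ κ Q = P ∧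
      IsOrientedChart₂ X'.orientation ψ ∧ Q ∈ ψ.source ∧ ψ Q = 0 ∧ 2 ≤ b ∧
      MapsTo κ ψ.source φ.source ∧ (∀ y ∈ ψ.source, φ (κ y) = ((ψ y).1 ^ b, (ψ y).2)) ∧
      0 < r ∧ Metric.ball 0 r ⊆ φ.target ∧
      ∀ x ∈ φ.source, φ x ∈ Metric.ball 0 r → (x ∈ branchLocus κ ↔ (φ x).1 = 0) := by
  obtain ⟨φ, hφ, hP, hP0, hQ, hev⟩ := hκ.eventually_mem_branchLocus P
  obtain ⟨Q, hQc, rfl⟩ := hPB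
  obtain ⟨ψ, b, hψ, hQψ, hQ0, hb, hmaps, hmodel⟩ := hQ Q rfl
  have hb2 := ((mem_critSet_iff_of_branch hκ.contMDiff hb hmaps hmodel hQψ).1 hQc).1
  have hsymm : Tendsto φ.symm (𝓝 0) (𝓝 (κ Q)) := by
    have := (φ.contMDiffAt_symm (φ.mem_target hP)).continuousAt.tendsto
    rwa [φ.symm_apply hP, hP0] at this
  have htarget : φ.target ∈ 𝓝 0 := by rw [← hP0]; exact φ.target_mem_nhds (φ.mem_target hP)
  have hψtarget : ψ.target ∈ 𝓝 0 := by rw [← hQ0]; exact ψ.target_mem_nhds (ψ.mem_target hQψ)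
  obtain ⟨r, hr, hball⟩ := Metric.nhds_basis_ball.mem_iff.1
    (inter_mem (inter_mem htarget hψtarget) (hsymm.eventually hev))
  refine ⟨φ, Q, ψ, b, r, hφ, hP, hP0, rfl, hψ, hQψ, hQ0, hb2, hmaps, hmodel, hr,
    fun z hz => (hball hz).1.1, fun x hx hxr => ⟨fun h => ?_, fun h => ?_⟩⟩
  · have h1 := (hball hxr).2
    simp only [mem_ofPred_eq, φ.symm_apply hx] at h1
    exact (h1 h).2
  · have hz := (hball hxr).1.2
    refine ⟨ψ.symm (φ x), ?_, ?_⟩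
    · rw [mem_critSet_iff_of_branch hκ.contMDiff hb hmaps hmodel (ψ.symm_mem_source hz),
        ψ.apply_symm hz]
      exact ⟨hb2, h⟩
    · have h1 := hmodel _ (ψ.symm_mem_source hz)
      rw [ψ.apply_symm hz, h, zero_pow (by omega)] at h1
      refine φ.toPartialEquiv.injOn (hmaps (ψ.symm_mem_source hz)) hx (h1.trans ?_)
      exact Prod.ext h.symm rfl

/-- Nearby points of the branch locus lie in the same connected component. -/
lemma mem_nonVerticalBranchLocus_iff {X' X : FourManifoldOverS2} {κ : X' → X} {P : X}
    (hPB : P ∈ branchLocus κ) {φ : PartialDiffeomorph (𝓡 4) 𝓘(ℝ, ℂ × ℂ) X (ℂ × ℂ) ∞}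
    (hP : P ∈ φ.source) (hP0 : φ P = 0) {r : ℝ} (hr : 0 < r)
    (hball : Metric.ball 0 r ⊆ φ.target)
    (hB : ∀ x ∈ φ.source, φ x ∈ Metric.ball 0 r → (x ∈ branchLocus κ ↔ (φ x).1 = 0))
    {x : X} (hx : x ∈ φ.source) (hxr : φ x ∈ Metric.ball 0 r) (hxB : x ∈ branchLocus κ) :
    x ∈ nonVerticalBranchLocus κ ↔ P ∈ nonVerticalBranchLocus κ := by
  have hsub : (fun w : ℂ => ((0 : ℂ), w)) '' Metric.ball 0 r ⊆ Metric.ball 0 r := by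
    rintro _ ⟨w, hw, rfl⟩
    simpa [Prod.norm_def] using hw
  have hpre : IsPreconnected
      (φ.symm '' ((fun w : ℂ => ((0 : ℂ), w)) '' Metric.ball 0 r)) := by
    refine IsPreconnected.image ?_ _ (φ.symm.contMDiffOn.continuousOn.mono (hsub.trans hball))
    exact (convex_ball (0 : ℂ) r).isPreconnected.image _ (by fun_prop)
  have hin : ∀ y ∈ φ.source, φ y ∈ Metric.ball 0 r → y ∈ branchLocus κ →
      y ∈ φ.symm '' ((fun w : ℂ => ((0 : ℂ), w)) '' Metric.ball 0 r) := by
    intro y hy hyr hyB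
    have h0 := (hB y hy hyr).1 hyB
    refine ⟨φ y, ⟨(φ y).2, ?_, Prod.ext h0.symm rfl⟩, φ.symm_apply hy⟩
    rw [mem_ball_zero_iff] at hyr ⊢
    exact (norm_snd_le _).trans_lt hyr
  have hsubB : φ.symm '' ((fun w : ℂ => ((0 : ℂ), w)) '' Metric.ball 0 r) ⊆ branchLocus κ := by
    rintro _ ⟨z, hz, rfl⟩
    have hzr := hsub hz
    have hzt := hball hzr
    refine (hB _ (φ.symm_mem_source hzt) (by rwa [φ.apply_symm hzt])).2 ?_
    rw [φ.apply_symm hzt]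
    obtain ⟨w, -, rfl⟩ := hz
    rfl
  have hPin := hin P hP (by rw [hP0]; exact Metric.mem_ball_self hr) hPB
  have hcc : connectedComponentIn (branchLocus κ) x = connectedComponentIn (branchLocus κ) P :=
    (connectedComponentIn_eq (hpre.subset_connectedComponentIn hPin hsubB
      (hin x hx hxr hxB))).symm
  simp only [nonVerticalBranchLocus, mem_ofPred_eq, hcc, hxB, hPB]

lemma IsBranchedCovering.isClosed_nonVerticalBranchLocus {X' X : FourManifoldOverS2} {κ : X' → X}
    (hκ : IsBranchedCovering κ) : IsClosed (nonVerticalBranchLocus κ) := by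
  rw [← isOpen_compl_iff, isOpen_iff_mem_nhds]
  intro P hP
  by_cases hPB : P ∈ branchLocus κ
  · obtain ⟨φ, Q, ψ, b, r, -, hPs, hP0, -, -, -, -, -, -, -, hr, hball, hB⟩ := hκ.exists_model hPB
    have hc := (φ.contMDiffAt' hPs).continuousAt
    have h1 : φ ⁻¹' Metric.ball 0 r ∈ 𝓝 P :=
      hc.preimage_mem_nhds (by rw [hP0]; exact Metric.ball_mem_nhds _ hr)
    filter_upwards [φ.source_mem_nhds hPs, h1] with x hx hxr hxB
    exact hP ((mem_nonVerticalBranchLocus_iff hPB hPs hP0 hr hball hB hx hxr hxB.1).1 hxB)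
  · obtain ⟨φ, -, -, -, -, hev⟩ := hκ.eventually_mem_branchLocus P
    filter_upwards [hev] with x hx hxB
    exact hPB (hx hxB.1).1

/-! ### Two-forms in coordinates -/

/-- The value of a smooth 2-form on two coordinate vector fields of a smooth map is continuous. -/
lemma TwoForm.continuousAt_apply_mfderiv {n : ℕ} {X : Type*} [TopologicalSpace X]
    [ChartedSpace (EuclideanSpace ℝ (Fin n)) X] [IsManifold (𝓡 n) ∞ X] {η : TwoForm n X}
    (hη : ∀ x : X, ContDiffOn ℝ ∞ (TwoForm.inChart η x) (extChartAt (𝓡 n) x).target)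
    {E : Type*} [NormedAddCommGroup E] [NormedSpace ℝ E] {c : E → X} {z₀ : E}
    (hc : ContMDiffAt 𝓘(ℝ, E) (𝓡 n) ∞ c z₀) (e₁ e₂ : E) :
    ContinuousAt (fun z => η (c z) ![mfderiv 𝓘(ℝ, E) (𝓡 n) c z e₁,
      mfderiv 𝓘(ℝ, E) (𝓡 n) c z e₂]) z₀ := by
  set χ := extChartAt (𝓡 n) (c z₀) with hχ
  have hmem : c z₀ ∈ χ.source := mem_extChartAt_source _
  have hχc : ContMDiffAt (𝓡 n) 𝓘(ℝ, EuclideanSpace ℝ (Fin n)) ∞ χ (c z₀) :=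
    contMDiffAt_extChartAt
  have hg : ContDiffAt ℝ ∞ (χ ∘ c) z₀ := contMDiffAt_iff_contDiffAt.1 (hχc.comp z₀ hc)
  have htarget : IsOpen χ.target := isOpen_extChartAt_target _
  have hcont : ContinuousAt (fun z => TwoForm.inChart η (c z₀) ((χ ∘ c) z)
      ![fderiv ℝ (χ ∘ c) z e₁, fderiv ℝ (χ ∘ c) z e₂]) z₀ := by
    have h1 : ContinuousAt (TwoForm.inChart η (c z₀)) ((χ ∘ c) z₀) :=
      (hη (c z₀)).continuousOn.continuousAt (htarget.mem_nhds (χ.map_source hmem))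
    have h2 : ContinuousAt (fderiv ℝ (χ ∘ c)) z₀ :=
      (hg.fderiv_right (m := 0) (by simp)).continuousAt
    refine ContinuousAt.eval (h1.comp hg.continuousAt) (continuousAt_pi.2 fun i => ?_)
    fin_cases i
    · exact h2.clm_apply continuousAt_const
    · exact h2.clm_apply continuousAt_const
  refine hcont.congr ?_
  have hsrc : ∀ᶠ z in 𝓝 z₀, c z ∈ χ.source :=
    hc.continuousAt.preimage_mem_nhds ((isOpen_extChartAt_source _).mem_nhds hmem)
  filter_upwards [hsrc.eventually_nhds, (hg.of_le (m := 1) (by simp)).eventually (by simp)]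
    with z hz hgz
  have hzs : c z ∈ χ.source := hz.self_of_nhds
  have hsymm : MDifferentiableAt 𝓘(ℝ, EuclideanSpace ℝ (Fin n)) (𝓡 n) χ.symm ((χ ∘ c) z) :=
    ((contMDiffOn_extChartAt_symm (n := ∞) (c z₀)).contMDiffAt
      (htarget.mem_nhds (χ.map_source hzs))).mdifferentiableAt (by simp)
  have heq : χ.symm ∘ (χ ∘ c) =ᶠ[𝓝 z] c := by
    filter_upwards [hz] with y hy using χ.left_inv hy
  have hd := heq.mfderiv_eq (I := 𝓘(ℝ, E)) (I' := 𝓡 n)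
  rw [mfderiv_comp z hsymm (hgz.differentiableAt (by simp)).mdifferentiableAt,
    mfderiv_eq_fderiv] at hd
  have key : ∀ (x y : X) (A B : E →L[ℝ] EuclideanSpace ℝ (Fin n)), x = y → A = B →
      (η x : (EuclideanSpace ℝ (Fin n)) [⋀^Fin 2]→L[ℝ] ℝ) ![A e₁, A e₂] =
      (η y : (EuclideanSpace ℝ (Fin n)) [⋀^Fin 2]→L[ℝ] ℝ) ![B e₁, B e₂] := by
    rintro x _ A _ rfl rfl
    rfl
  refine Eq.trans ?_ (key _ _ _ _ heq.self_of_nhds hd)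
  exact congrArg (η (χ.symm ((χ ∘ c) z))) (funext fun i => by fin_cases i <;> rfl)

section PlaneForms

variable {V : Type*} [AddCommGroup V] [Module ℝ V] [TopologicalSpace V]

/-- In oriented complex coordinates, a positive form on an oriented plane is a positive multiple of
the determinant. -/
lemma exists_pos_forall_apply_eq {o : Orientation ℝ V (Fin 2)} {L : V → ℂ}
    (hL : IsOrientedIso o Complex.orientation L) (η : V [⋀^Fin 2]→L[ℝ] ℝ)
    (hη : ∀ v, IsPositiveFrame o v → 0 < η v) :
    ∃ ρ : ℝ, 0 < ρ ∧ ∀ v₁ v₂ : V, η ![v₁, v₂] = ρ * det₂ (L v₁) (L v₂) := by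
  have hL' := hL
  obtain ⟨e, he, -⟩ := hL'
  set b := Complex.basisOneI.map e.symm with hb
  refine ⟨η b, hη _ (isPositiveFrame_of_det_pos Complex.basisOneI hL ?_), fun v₁ v₂ => ?_⟩
  · have : L ∘ b = Complex.basisOneI := by
      funext i
      simp [hb, ← he]
    rw [this, Module.Basis.det_self]
    exact one_pos
  · have h1 := η.toAlternatingMap.eq_smul_basis_det b
    have h2 := DFunLike.congr_fun h1 ![v₁, v₂]
    refine h2.trans ?_
    have h3 : b.det ![v₁, v₂] = det₂ (L v₁) (L v₂) := by
      rw [← basisOneI_det, hb, Module.Basis.det_map]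
      congr 1
      funext i
      fin_cases i <;> simp [he]
    rw [← h3]
    rfl

lemma alternating_apply_smul_add (η : V [⋀^Fin 2]→L[ℝ] ℝ) (e₁ e₂ : V) (s t : ℝ) :
    η ![s • e₁ + t • e₂, e₂] = s * η ![e₁, e₂] ∧
      η ![s • e₁ + t • e₂, e₁] = - t * η ![e₁, e₂] := by
  have hsw : η ![e₂, e₁] = - η ![e₁, e₂] := by
    have h := η.map_swap ![e₁, e₂] (i := 0) (j := 1) (by simp)
    refine Eq.trans (congrArg η ?_) h
    funext i
    fin_cases i <;> rfl
  have hz : ∀ e, η ![e, e] = 0 := fun e =>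
    η.map_eq_zero_of_eq ![e, e] (i := 0) (j := 1) rfl (by simp)
  have hadd : ∀ e, η ![s • e₁ + t • e₂, e] = s * η ![e₁, e] + t * η ![e₂, e] := by
    intro e
    have h1 := η.toMultilinearMap.map_update_add ![0, e] 0 (s • e₁) (t • e₂)
    have h2 := η.toMultilinearMap.map_update_smul ![0, e] 0 s e₁
    have h3 := η.toMultilinearMap.map_update_smul ![0, e] 0 t e₂
    rw [h2, h3] at h1
    have hu : ∀ v : V, Function.update ![0, e] 0 v = ![v, e] := by
      intro v; funext i; fin_cases i <;> simp
    simp only [hu] at h1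
    exact h1
  rw [hadd, hadd, hz, hz, hsw]
  constructor <;> ring

end PlaneForms

lemma det₂_map (L : ℂ →L[ℝ] ℂ) (x y : ℂ) :
    det₂ (L x) (L y) = det₂ (L 1) (L Complex.I) * det₂ x y := by
  have h : ∀ z : ℂ, L z = z.re • L 1 + z.im • L Complex.I := fun z => by
    rw [← map_smul, ← map_smul, ← map_add, ← Complex.eq_re_smul_add_im_smul]
  rw [h x, h y]
  simp [det₂]
  ring

lemma orientedFrame_det₄ {V : Type*} [AddCommGroup V] [Module ℝ V] {o : Orientation ℝ V (Fin 4)}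
    {L : V → ℂ × ℂ} (hL : IsOrientedIso o complexOrientation₂ L) {a b c d : V}
    (h : 0 < det₄ (L a) (L b) (L c) (L d)) : IsPositiveFrame o ![a, b, c, d] := by
  refine isPositiveFrame_of_det_pos complexBasis₂ hL ?_
  rw [complexBasis₂_det]
  exact h

lemma orientedFrame_det₂ {V : Type*} [AddCommGroup V] [Module ℝ V] {o : Orientation ℝ V (Fin 2)}
    {L : V → ℂ} (hL : IsOrientedIso o Complex.orientation L) {a b : V}
    (h : 0 < det₂ (L a) (L b)) : IsPositiveFrame o ![a, b] := by
  refine isPositiveFrame_of_det_pos Complex.basisOneI hL ?_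
  rw [← basisOneI_det] at h
  convert h using 2
  funext i
  fin_cases i <;> rfl

lemma det₄_transition_pos {V : Type*} [AddCommGroup V] [Module ℝ V] {o : Orientation ℝ V (Fin 4)}
    {L L' : V → ℂ × ℂ} (hL : IsOrientedIso o complexOrientation₂ L)
    (hL' : IsOrientedIso o complexOrientation₂ L') {E : ℂ × ℂ → V} (hE : ∀ w, L (E w) = w) :
    0 < det₄ (L' (E (1, 0))) (L' (E (Complex.I, 0))) (L' (E (0, 1)))
      (L' (E (0, Complex.I))) := by
  have h := det_pos_of_isOrientedIso complexBasis₂ hL hL' hE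
  rw [complexBasis₂_det] at h
  have h0 : (finSumFinEquiv : Fin 2 ⊕ Fin 2 ≃ Fin 4).symm 0 = Sum.inl 0 := rfl
  have h1 : (finSumFinEquiv : Fin 2 ⊕ Fin 2 ≃ Fin 4).symm 1 = Sum.inl 1 := rfl
  have h2 : (finSumFinEquiv : Fin 2 ⊕ Fin 2 ≃ Fin 4).symm 2 = Sum.inr 0 := rfl
  have h3 : (finSumFinEquiv : Fin 2 ⊕ Fin 2 ≃ Fin 4).symm 3 = Sum.inr 1 := rfl
  have b0 : complexBasis₂ 0 = (1, 0) := by simp [complexBasis₂, h0]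
  have b1 : complexBasis₂ 1 = (Complex.I, 0) := by simp [complexBasis₂, h1]
  have b2 : complexBasis₂ 2 = (0, 1) := by simp [complexBasis₂, h2]
  have b3 : complexBasis₂ 3 = (0, Complex.I) := by simp [complexBasis₂, h3]
  rwa [b0, b1, b2, b3] at h

/-! ### Tangencies of the branch locus with the fibers -/

/-- A monomial with a non-zero derivative at a point is submersive there. -/
lemma surjective_smul_fst_add_smul_snd {E : Type*} {A C : E → ℂ} {α β : ℂ}
    (hs : Function.Surjective fun v => (A v, C v)) (h : α ≠ 0 ∨ β ≠ 0) :
    Function.Surjective fun v => α * A v + β * C v := by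
  intro ζ
  rcases h with h | h
  · obtain ⟨v, hv⟩ := hs (ζ / α, 0)
    simp only [Prod.mk.injEq] at hv
    refine ⟨v, ?_⟩
    simp only [hv.1, hv.2]
    field_simp
    ring
  · obtain ⟨v, hv⟩ := hs (0, ζ / β)
    simp only [Prod.mk.injEq] at hv
    refine ⟨v, ?_⟩
    simp only [hv.1, hv.2]
    field_simp
    ring

section Local

variable {oS : ManifoldOrientation 2 S2} {M' : FourManifoldOverS2.{u}} {N : FourManifoldOverS2.{v}}
  {κ : M' → N} {φ : PartialDiffeomorph (𝓡 4) 𝓘(ℝ, ℂ × ℂ) N (ℂ × ℂ) ∞}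
  {ψ : PartialDiffeomorph (𝓡 4) 𝓘(ℝ, ℂ × ℂ) M' (ℂ × ℂ) ∞} {b : ℕ}

lemma branch_symm_eq (hmaps : MapsTo κ ψ.source φ.source)
    (hmodel : ∀ y ∈ ψ.source, φ (κ y) = ((ψ y).1 ^ b, (ψ y).2)) {X : ℂ × ℂ} (hX : X ∈ ψ.target) :
    κ (ψ.symm X) = φ.symm (X.1 ^ b, X.2) := by
  have h1 := hmodel _ (ψ.symm_mem_source hX)
  rw [ψ.apply_symm hX] at h1
  rw [← h1, φ.symm_apply (hmaps (ψ.symm_mem_source hX))]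

/-- Where the branch locus is not transverse to the fiber, it is tangent to it, and the projection
of the branch locus to the sphere has a definite sign nearby: with respect to the orientation of
the fiber it does not reverse the orientation. Here `ζ₁` and `ζ₂` are the vectors of the `z`-plane
that the projection maps to `1` and `i` in the coordinate `t`, so that `det₂ ζ₁ ζ₂` carries the
sign by which the projection respects the orientation of the directions normal to the fiber. -/
lemma exists_chart_of_not_surjective
    (hfactor : ∀ x, N.proj (κ x) = M'.proj x)
    (hmono : ∀ x ∈ critSet (m := 4) (n := 2) M'.proj, IsMonomialAt oS M' x)
    (hψ : IsOrientedChart₂ M'.orientation ψ)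
    (hmaps : MapsTo κ ψ.source φ.source)
    (hmodel : ∀ y ∈ ψ.source, φ (κ y) = ((ψ y).1 ^ b, (ψ y).2))
    (hb : 2 ≤ b) (h0φ : 0 ∈ φ.target) (h0ψ : 0 ∈ ψ.target)
    (hcrit : φ.symm 0 ∉ critSet (m := 4) (n := 2) N.proj)
    (hns : ¬ Function.Surjective
      fun y : ℂ => mfderiv 𝓘(ℝ, ℂ × ℂ) (𝓡 2) (N.proj ∘ φ.symm) 0 ((0 : ℂ), y)) :
    ∃ (t : PartialDiffeomorph (𝓡 2) 𝓘(ℝ, ℂ) S2 ℂ ∞) (ζ₁ ζ₂ : ℂ), IsOrientedChart₁ oS t ∧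
      N.proj (φ.symm 0) ∈ t.source ∧
      (∀ y : ℂ, fderiv ℝ (t ∘ N.proj ∘ φ.symm) 0 (0, y) = 0) ∧
      fderiv ℝ (t ∘ N.proj ∘ φ.symm) 0 (ζ₁, 0) = 1 ∧
      fderiv ℝ (t ∘ N.proj ∘ φ.symm) 0 (ζ₂, 0) = Complex.I ∧ det₂ ζ₁ ζ₂ ≠ 0 ∧
      ∀ᶠ w in 𝓝 (0 : ℂ), 0 ≤ det₂ ζ₁ ζ₂ *
        det₂ (fderiv ℝ (t ∘ N.proj ∘ φ.symm) (0, w) (0, 1))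
          (fderiv ℝ (t ∘ N.proj ∘ φ.symm) (0, w) (0, Complex.I)) := by
  set F : ℂ × ℂ → S2 := N.proj ∘ φ.symm with hF
  set Br : ℂ × ℂ → ℂ × ℂ := fun X => (X.1 ^ b, X.2) with hBr
  have hBr0 : Br 0 = 0 := by simp [hBr, show b ≠ 0 by omega, ← Prod.zero_eq_mk]
  have hBrd : ∀ v : ℂ × ℂ, fderiv ℝ Br 0 v = (0, v.2) := fun v => by
    rw [(hasFDerivAt_branch b 0).fderiv]
    simp [show b - 1 ≠ 0 by omega]
  have hBrdiff : DifferentiableAt ℝ Br 0 := (hasFDerivAt_branch b 0).differentiableAt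
  have hc : ContMDiffAt 𝓘(ℝ, ℂ × ℂ) (𝓡 4) ∞ φ.symm 0 := φ.contMDiffAt_symm h0φ
  have hFs : ContMDiffAt 𝓘(ℝ, ℂ × ℂ) (𝓡 2) ∞ F 0 := (N.contMDiff_proj _).comp 0 hc
  have hψs : ContMDiffAt 𝓘(ℝ, ℂ × ℂ) (𝓡 4) ∞ ψ.symm 0 := ψ.contMDiffAt_symm h0ψ
  have hqF : ∀ X ∈ ψ.target, M'.proj (ψ.symm X) = F (Br X) := fun X hX => by
    rw [← hfactor, branch_symm_eq hmaps hmodel hX]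
    rfl
  have hF0 : F 0 = M'.proj (ψ.symm 0) := by rw [hqF 0 h0ψ, hBr0]
  have hQ : ψ.symm 0 ∈ critSet (m := 4) (n := 2) M'.proj := by
    intro hs
    apply hns
    have h1 : M'.proj ∘ ψ.symm =ᶠ[𝓝 0] F ∘ Br := by
      filter_upwards [ψ.target_mem_nhds h0ψ] with X hX using hqF X hX
    have h2 := h1.mfderiv_eq (I := 𝓘(ℝ, ℂ × ℂ)) (I' := 𝓡 2)
    rw [mfderiv_comp 0 ((M'.contMDiff_proj _).mdifferentiableAt (by simp))
      (hψs.mdifferentiableAt (by simp)),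
      mfderiv_comp_of_eq (hFs.mdifferentiableAt (by simp)) hBrdiff.mdifferentiableAt hBr0,
      mfderiv_eq_fderiv] at h2
    have h3 : Function.Surjective
        (mfderiv (𝓡 4) (𝓡 2) M'.proj (ψ.symm 0) ∘ mfderiv 𝓘(ℝ, ℂ × ℂ) (𝓡 4) ψ.symm 0) :=
      hs.comp (ψ.symm.openPartialHomeomorph_mdifferentiable.mfderiv_surjective h0ψ)
    intro v
    obtain ⟨X, hX⟩ := h3 v
    have h4 : ∀ z : ℂ × ℂ, z = 0 → ∀ Y : ℂ × ℂ,
        (mfderiv 𝓘(ℝ, ℂ × ℂ) (𝓡 2) F z Y : EuclideanSpace ℝ (Fin 2)) =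
          mfderiv 𝓘(ℝ, ℂ × ℂ) (𝓡 2) F 0 Y := by
      rintro _ rfl _
      rfl
    exact ⟨X.2, (congrArg (fun Y : ℂ × ℂ => (mfderiv 𝓘(ℝ, ℂ × ℂ) (𝓡 2) F 0 Y :
      EuclideanSpace ℝ (Fin 2))) (hBrd X)).symm.trans
        ((h4 _ hBr0 _).symm.trans ((DFunLike.congr_fun h2 X).symm.trans hX))⟩
  obtain ⟨h, t, m, n, ht, hmn, htsrc, hh, hhiso, hev⟩ := hmono _ hQ
  have htF : F 0 ∈ t.source := by rw [hF0]; exact htsrc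
  set f : ℂ × ℂ → ℂ := t ∘ F with hf
  set θ : ℂ × ℂ → ℂ × ℂ := h ∘ ψ.symm with hθ
  have htd : ContMDiffAt (𝓡 2) 𝓘(ℝ, ℂ) ∞ t (F 0) := t.contMDiffAt' htF
  have hfs : ContDiffAt ℝ ∞ f 0 := contMDiffAt_iff_contDiffAt.1 (htd.comp 0 hFs)
  have hθs : ContDiffAt ℝ ∞ θ 0 := contMDiffAt_iff_contDiffAt.1 (hh.comp 0 hψs)
  have hfd : ∀ v : ℂ × ℂ, fderiv ℝ f 0 v =
      mfderiv (𝓡 2) 𝓘(ℝ, ℂ) t (F 0) (mfderiv 𝓘(ℝ, ℂ × ℂ) (𝓡 2) F 0 v) := fun v => by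
    rw [← mfderiv_eq_fderiv, mfderiv_comp 0 (htd.mdifferentiableAt (by simp))
      (hFs.mdifferentiableAt (by simp))]
    rfl
  have hθd : ∀ v : ℂ × ℂ, fderiv ℝ θ 0 v =
      mfderiv (𝓡 4) 𝓘(ℝ, ℂ × ℂ) h (ψ.symm 0) (mfderiv 𝓘(ℝ, ℂ × ℂ) (𝓡 4) ψ.symm 0 v) := fun v => by
    rw [← mfderiv_eq_fderiv, mfderiv_comp 0 (hh.mdifferentiableAt (by simp))
      (hψs.mdifferentiableAt (by simp))]
    rfl
  have htbij := t.openPartialHomeomorph_mdifferentiable.mfderiv_bijective htF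
  have hfac : ∀ᶠ X in 𝓝 (0 : ℂ × ℂ), (θ X).1 ^ m * (θ X).2 ^ n = f (X.1 ^ b, X.2) := by
    filter_upwards [hψs.continuousAt.eventually hev, ψ.target_mem_nhds h0ψ] with X hX hXt
    rw [hqF X hXt] at hX
    exact hX.symm
  have hdet : 0 < det₄ (fderiv ℝ θ 0 (1, 0)) (fderiv ℝ θ 0 (Complex.I, 0))
      (fderiv ℝ θ 0 (0, 1)) (fderiv ℝ θ 0 (0, Complex.I)) := by
    simp only [hθd]
    exact det₄_transition_pos (hψ _ (ψ.symm_mem_source h0ψ)) hhiso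
      (E := mfderiv 𝓘(ℝ, ℂ × ℂ) (𝓡 4) ψ.symm 0) (ψ.mfderiv_mfderiv_symm h0ψ)
  have hθsurj : Function.Surjective (fderiv ℝ θ 0) :=
    LinearMap.injective_iff_surjective (f := (fderiv ℝ θ 0 : ℂ × ℂ →ₗ[ℝ] ℂ × ℂ)).1
      (injective_of_det₄_ne_zero _ hdet.ne')
  -- A monomial has rank zero or two, so that the fibration is constant to first order along the
  -- branch locus as soon as it is not submersive there.
  have hfw : ∀ y : ℂ, fderiv ℝ f 0 (0, y) = 0 := by
    have hF' : HasFDerivAt (f ∘ Br) ((fderiv ℝ f 0).comp (fderiv ℝ Br 0)) 0 := by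
      refine HasFDerivAt.comp (g := f) (0 : ℂ × ℂ) ?_ hBrdiff.hasFDerivAt
      rw [hBr0]
      exact (hfs.differentiableAt (by simp)).hasFDerivAt
    have ha : HasFDerivAt (fun X => (θ X).1) ((ContinuousLinearMap.fst ℝ ℂ ℂ).comp (fderiv ℝ θ 0))
        0 := hasFDerivAt_fst.comp 0 (hθs.differentiableAt (by simp)).hasFDerivAt
    have hc' : HasFDerivAt (fun X => (θ X).2) ((ContinuousLinearMap.snd ℝ ℂ ℂ).comp (fderiv ℝ θ 0))
        0 := hasFDerivAt_snd.comp 0 (hθs.differentiableAt (by simp)).hasFDerivAt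
    have heq := (hasFDerivAt_monomial m n ha hc').unique (hF'.congr_of_eventuallyEq hfac)
    set α := (m : ℂ) * (θ 0).1 ^ (m - 1) * (θ 0).2 ^ n
    set β := (n : ℂ) * (θ 0).1 ^ m * (θ 0).2 ^ (n - 1)
    have heq' : ∀ v : ℂ × ℂ, α * (fderiv ℝ θ 0 v).1 + β * (fderiv ℝ θ 0 v).2 =
        fderiv ℝ f 0 (0, v.2) := fun v => by
      rw [← hBrd v]
      exact DFunLike.congr_fun heq v
    have hαβ : α = 0 ∧ β = 0 := by
      by_contra hcon
      have hor : α ≠ 0 ∨ β ≠ 0 := by tauto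
      have hsurj := surjective_smul_fst_add_smul_snd (A := fun v => (fderiv ℝ θ 0 v).1)
        (C := fun v => (fderiv ℝ θ 0 v).2) hθsurj hor
      apply hns
      intro v
      obtain ⟨X, hX⟩ := hsurj (mfderiv (𝓡 2) 𝓘(ℝ, ℂ) t (F 0) v)
      refine ⟨X.2, htbij.1 ?_⟩
      simp only [heq', hfd] at hX
      exact hX
    intro y
    rw [← heq' (0, y), hαβ.1, hαβ.2]
    simp
  have hfsurj : Function.Surjective (fderiv ℝ f 0) := by
    intro ζ
    obtain ⟨v, hv⟩ := htbij.2 ζ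
    have hs : Function.Surjective (mfderiv (𝓡 4) (𝓡 2) N.proj (φ.symm 0)) := not_not.1 hcrit
    obtain ⟨x, hx⟩ := hs v
    obtain ⟨X, hX⟩ := φ.symm.openPartialHomeomorph_mdifferentiable.mfderiv_surjective h0φ x
    have hFd : mfderiv 𝓘(ℝ, ℂ × ℂ) (𝓡 2) F 0 X = mfderiv (𝓡 4) (𝓡 2) N.proj (φ.symm 0)
        (mfderiv 𝓘(ℝ, ℂ × ℂ) (𝓡 4) φ.symm 0 X) := by
      rw [hF, mfderiv_comp 0
        ((N.contMDiff_proj _).mdifferentiableAt (by simp)) (hc.mdifferentiableAt (by simp))]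
      rfl
    exact ⟨X, (hfd X).trans ((congrArg (mfderiv (𝓡 2) 𝓘(ℝ, ℂ) t (F 0))
      (hFd.trans ((congrArg (mfderiv (𝓡 4) (𝓡 2) N.proj (φ.symm 0)) hX).trans hx))).trans hv)⟩
  have hsplit : ∀ X : ℂ × ℂ, fderiv ℝ f 0 (X.1, 0) = fderiv ℝ f 0 X := fun X => by
    have : X = (X.1, 0) + (0, X.2) := by simp
    nth_rewrite 2 [this]
    rw [map_add, hfw, add_zero]
  obtain ⟨X₁, hX₁⟩ := hfsurj 1
  obtain ⟨X₂, hX₂⟩ := hfsurj Complex.I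
  rw [← hsplit] at hX₁ hX₂
  have hprod : det₂ (fderiv ℝ f 0 (1, 0)) (fderiv ℝ f 0 (Complex.I, 0)) * det₂ X₁.1 X₂.1 = 1 := by
    have := det₂_map ((fderiv ℝ f 0).comp (ContinuousLinearMap.inl ℝ ℂ ℂ)) X₁.1 X₂.1
    simp only [ContinuousLinearMap.comp_apply, ContinuousLinearMap.inl_apply, hX₁, hX₂] at this
    rw [← this]
    simp [det₂]
  have hA : det₂ (fderiv ℝ f 0 (1, 0)) (fderiv ℝ f 0 (Complex.I, 0)) ≠ 0 :=
    left_ne_zero_of_mul (by rw [hprod]; exact one_ne_zero)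
  refine ⟨t, X₁.1, X₂.1, ht, htF, hfw, hX₁, hX₂,
    right_ne_zero_of_mul (by rw [hprod]; exact one_ne_zero), ?_⟩
  have h2 : (2 : WithTop ℕ∞) ≤ ∞ := WithTop.coe_le_coe.2 le_top
  filter_upwards [eventually_nonneg_of_monomial hb hmn (hfs.of_le h2) (hθs.of_le h2) hfac hfw hA
    hdet] with w hw
  refine nonneg_of_mul_nonneg_right (a := det₂ (fderiv ℝ f 0 (1, 0))
    (fderiv ℝ f 0 (Complex.I, 0)) ^ 2) ?_ (by positivity)
  calc (0 : ℝ) ≤ _ := hw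
    _ = _ := by
      linear_combination (-det₂ (fderiv ℝ f 0 (1, 0)) (fderiv ℝ f 0 (Complex.I, 0)) *
        det₂ (fderiv ℝ f (0, w) (0, 1)) (fderiv ℝ f (0, w) (0, Complex.I))) * hprod

end Local

/-! ### Non-degeneracy of the perturbed form on the branch locus -/

section Local

variable {oS : ManifoldOrientation 2 S2} {M' : FourManifoldOverS2.{u}} {N : FourManifoldOverS2.{v}}
  {κ : M' → N} {φ : PartialDiffeomorph (𝓡 4) 𝓘(ℝ, ℂ × ℂ) N (ℂ × ℂ) ∞}
  {ψ : PartialDiffeomorph (𝓡 4) 𝓘(ℝ, ℂ × ℂ) M' (ℂ × ℂ) ∞} {b : ℕ}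

lemma mfderiv_proj_comp_symm {z : ℂ × ℂ} (hz : z ∈ φ.target) (v : ℂ × ℂ) :
    mfderiv 𝓘(ℝ, ℂ × ℂ) (𝓡 2) (N.proj ∘ φ.symm) z v =
      mfderiv (𝓡 4) (𝓡 2) N.proj (φ.symm z) (mfderiv 𝓘(ℝ, ℂ × ℂ) (𝓡 4) φ.symm z v) := by
  rw [mfderiv_comp z ((N.contMDiff_proj _).mdifferentiableAt (by simp))
    ((φ.contMDiffAt_symm hz).mdifferentiableAt (by simp))]
  rfl

lemma perturbed_apply (ωN : TwoForm 4 N) (ωS : TwoForm 2 S2) (k : ℝ) {z : ℂ × ℂ}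
    (hz : z ∈ φ.target) (v w : ℂ × ℂ) :
    (ωN (φ.symm z) + k • TwoForm.pullback (m := 4) ωS N.proj (φ.symm z))
      ![mfderiv 𝓘(ℝ, ℂ × ℂ) (𝓡 4) φ.symm z v, mfderiv 𝓘(ℝ, ℂ × ℂ) (𝓡 4) φ.symm z w] =
    ωN (φ.symm z)
      ![mfderiv 𝓘(ℝ, ℂ × ℂ) (𝓡 4) φ.symm z v, mfderiv 𝓘(ℝ, ℂ × ℂ) (𝓡 4) φ.symm z w] +
    k * ωS ((N.proj ∘ φ.symm) z) ![mfderiv 𝓘(ℝ, ℂ × ℂ) (𝓡 2) (N.proj ∘ φ.symm) z v,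
      mfderiv 𝓘(ℝ, ℂ × ℂ) (𝓡 2) (N.proj ∘ φ.symm) z w] := by
  have h : TwoForm.pullback (m := 4) ωS N.proj (φ.symm z)
      ![mfderiv 𝓘(ℝ, ℂ × ℂ) (𝓡 4) φ.symm z v, mfderiv 𝓘(ℝ, ℂ × ℂ) (𝓡 4) φ.symm z w] =
      ωS ((N.proj ∘ φ.symm) z) ![mfderiv 𝓘(ℝ, ℂ × ℂ) (𝓡 2) (N.proj ∘ φ.symm) z v,
      mfderiv 𝓘(ℝ, ℂ × ℂ) (𝓡 2) (N.proj ∘ φ.symm) z w] := by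
    refine congrArg (ωS (N.proj (φ.symm z))) (funext fun i => ?_)
    fin_cases i
    · exact (mfderiv_proj_comp_symm hz v).symm
    · exact (mfderiv_proj_comp_symm hz w).symm
  rw [← h]
  rfl

/-- If the projection is non-degenerate on the branch locus, the pulled-back form dominates. -/
lemma eventually_add_mul_ne_zero {G H : ℂ → ℝ} (hG : ContinuousAt G 0) (hH : ContinuousAt H 0)
    (h0 : H 0 ≠ 0) : ∃ k₀ : ℝ, ∀ᶠ w in 𝓝 (0 : ℂ), ∀ k : ℝ, k₀ ≤ k → G w + k * H w ≠ 0 := by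
  have hpos : 0 < |H 0| := abs_pos.2 h0
  refine ⟨(|G 0| + 1) / (|H 0| / 2), ?_⟩
  filter_upwards [hG.abs.eventually_lt_const (lt_add_one |G 0|),
    hH.abs.eventually_const_lt (half_lt_self hpos)] with w h1 h2 k hk hzero
  have h3 : |G 0| + 1 ≤ k * (|H 0| / 2) := (div_le_iff₀ (half_pos hpos)).1 hk
  have hk0 : 0 ≤ k := le_trans (by positivity) hk
  have h4 : |G w| = k * |H w| := by
    rw [eq_neg_of_add_eq_zero_left hzero, abs_neg, abs_mul, abs_of_nonneg hk0]
  have h5 : k * (|H 0| / 2) ≤ k * |H w| := mul_le_mul_of_nonneg_left h2.le hk0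
  linarith

/-- Near a point of the branch locus, the perturbed form does not vanish on the branch locus. If the
latter is tangent to the fiber at the point, then both forms have the sign of the orientation of the
fiber. -/
lemma eventually_perturbed_ne_zero
    (hfactor : ∀ x, N.proj (κ x) = M'.proj x)
    (hmono : ∀ x ∈ critSet (m := 4) (n := 2) M'.proj, IsMonomialAt oS M' x)
    {ωN : TwoForm 4 N} (hωN : IsSymplecticForm ωN) (hfib : HasSymplecticFibers oS N ωN)
    {ωS : TwoForm 2 S2} (hωS : IsSymplecticForm ωS) (hpos : IsPositiveForm oS ωS)
    (hφ : IsOrientedChart₂ N.orientation φ) (hψ : IsOrientedChart₂ M'.orientation ψ)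
    (hmaps : MapsTo κ ψ.source φ.source)
    (hmodel : ∀ y ∈ ψ.source, φ (κ y) = ((ψ y).1 ^ b, (ψ y).2))
    (hb : 2 ≤ b) (h0φ : 0 ∈ φ.target) (h0ψ : 0 ∈ ψ.target)
    (hcrit : φ.symm 0 ∉ critSet (m := 4) (n := 2) N.proj) :
    ∃ k₀ : ℝ, ∀ᶠ w in 𝓝 (0 : ℂ), ∀ k : ℝ, k₀ ≤ k →
      (ωN (φ.symm (0, w)) + k • TwoForm.pullback (m := 4) ωS N.proj (φ.symm (0, w)))
        ![mfderiv 𝓘(ℝ, ℂ × ℂ) (𝓡 4) φ.symm (0, w) ((0 : ℂ), (1 : ℂ)),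
          mfderiv 𝓘(ℝ, ℂ × ℂ) (𝓡 4) φ.symm (0, w) ((0 : ℂ), Complex.I)] ≠ 0 := by
  have hι : ContinuousAt (fun w : ℂ => ((0 : ℂ), w)) 0 := by fun_prop
  have htarget : ∀ᶠ w in 𝓝 (0 : ℂ), ((0 : ℂ), w) ∈ φ.target :=
    hι.preimage_mem_nhds (φ.target_mem_nhds h0φ)
  have hc : ContMDiffAt 𝓘(ℝ, ℂ × ℂ) (𝓡 4) ∞ φ.symm 0 := φ.contMDiffAt_symm h0φ
  have hF : ContMDiffAt 𝓘(ℝ, ℂ × ℂ) (𝓡 2) ∞ (N.proj ∘ φ.symm) 0 := (N.contMDiff_proj _).comp 0 hc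
  set G : ℂ × ℂ → ℝ := fun z => ωN (φ.symm z)
    ![mfderiv 𝓘(ℝ, ℂ × ℂ) (𝓡 4) φ.symm z ((0 : ℂ), (1 : ℂ)),
      mfderiv 𝓘(ℝ, ℂ × ℂ) (𝓡 4) φ.symm z ((0 : ℂ), Complex.I)] with hG
  set H : ℂ × ℂ → ℝ := fun z => ωS ((N.proj ∘ φ.symm) z)
    ![mfderiv 𝓘(ℝ, ℂ × ℂ) (𝓡 2) (N.proj ∘ φ.symm) z ((0 : ℂ), (1 : ℂ)),
      mfderiv 𝓘(ℝ, ℂ × ℂ) (𝓡 2) (N.proj ∘ φ.symm) z ((0 : ℂ), Complex.I)] with hH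
  have hGc : ContinuousAt (fun w : ℂ => G (0, w)) 0 :=
    ContinuousAt.comp (g := G) (f := fun w : ℂ => ((0 : ℂ), w))
      (TwoForm.continuousAt_apply_mfderiv hωN.smooth hc _ _) hι
  have hHc : ContinuousAt (fun w : ℂ => H (0, w)) 0 :=
    ContinuousAt.comp (g := H) (f := fun w : ℂ => ((0 : ℂ), w))
      (TwoForm.continuousAt_apply_mfderiv hωS.smooth hF _ _) hι
  suffices h : ∃ k₀ : ℝ, ∀ᶠ w in 𝓝 (0 : ℂ), ∀ k : ℝ, k₀ ≤ k → G (0, w) + k * H (0, w) ≠ 0 by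
    obtain ⟨k₀, hk₀⟩ := h
    refine ⟨k₀, ?_⟩
    filter_upwards [hk₀, htarget] with w hw hwt k hk
    rw [perturbed_apply ωN ωS k hwt]
    exact hw k hk
  by_cases hs : Function.Surjective
      fun y : ℂ => mfderiv 𝓘(ℝ, ℂ × ℂ) (𝓡 2) (N.proj ∘ φ.symm) 0 ((0 : ℂ), y)
  · refine eventually_add_mul_ne_zero hGc hHc ?_
    let ℓ : ℂ →ₗ[ℝ] EuclideanSpace ℝ (Fin 2) :=
      ((mfderiv 𝓘(ℝ, ℂ × ℂ) (𝓡 2) (N.proj ∘ φ.symm) 0 :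
        ℂ × ℂ →L[ℝ] EuclideanSpace ℝ (Fin 2)).comp (ContinuousLinearMap.inr ℝ ℂ ℂ)).toLinearMap
    have hℓs : Function.Surjective ℓ := hs
    have hℓi : Function.Injective ℓ :=
      (LinearMap.injective_iff_surjective_of_finrank_eq_finrank (by simp)).2 hℓs
    let B : Module.Basis (Fin 2) ℝ (EuclideanSpace ℝ (Fin 2)) :=
      Complex.basisOneI.map (LinearEquiv.ofBijective ℓ ⟨hℓi, hℓs⟩)
    have h1 := apply_basis_ne_zero_of_positive (oS.at' ((N.proj ∘ φ.symm) 0))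
      (ωS ((N.proj ∘ φ.symm) 0)) (hpos _) B
    have h2 : (B : Fin 2 → EuclideanSpace ℝ (Fin 2)) = ![ℓ 1, ℓ Complex.I] := by
      funext i
      fin_cases i
      · simp only [B, Fin.zero_eta, Module.Basis.map_apply, Complex.coe_basisOneI]
        rfl
      · simp only [B, Fin.mk_one, Module.Basis.map_apply, Complex.coe_basisOneI]
        rfl
    exact fun h => h1 ((congrArg (ωS ((N.proj ∘ φ.symm) 0)) h2).trans h)
  · obtain ⟨t, ζ₁, ζ₂, ht, htF, hfw, hζ₁, hζ₂, hζ, hsign⟩ := exists_chart_of_not_surjective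
      hfactor hmono hψ hmaps hmodel hb h0φ h0ψ hcrit hs
    have hfd : ∀ z ∈ φ.target, N.proj (φ.symm z) ∈ t.source → ∀ v : ℂ × ℂ,
        fderiv ℝ (t ∘ N.proj ∘ φ.symm) z v = mfderiv (𝓡 2) 𝓘(ℝ, ℂ) t ((N.proj ∘ φ.symm) z)
          (mfderiv 𝓘(ℝ, ℂ × ℂ) (𝓡 2) (N.proj ∘ φ.symm) z v) := fun z hz hzt v => by
      rw [← mfderiv_eq_fderiv, mfderiv_comp z ((t.contMDiffAt' hzt).mdifferentiableAt (by simp))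
        (((N.contMDiff_proj _).comp z (φ.contMDiffAt_symm hz)).mdifferentiableAt (by simp))]
      rfl
    have htev : ∀ᶠ w in 𝓝 (0 : ℂ), (N.proj ∘ φ.symm) (0, w) ∈ t.source :=
      (ContinuousAt.comp (g := N.proj ∘ φ.symm) (f := fun w : ℂ => ((0 : ℂ), w))
        hF.continuousAt hι).preimage_mem_nhds (t.source_mem_nhds htF)
    -- On the fiber, `ω_N` has the sign of the complex orientation of the branch locus if and only
    -- if the projection preserves the orientation of the normal direction.
    have hG0 : 0 < det₂ ζ₁ ζ₂ * G 0 := by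
      have hker : ∀ y : ℂ, mfderiv (𝓡 4) (𝓡 2) N.proj (φ.symm 0)
          (mfderiv 𝓘(ℝ, ℂ × ℂ) (𝓡 4) φ.symm 0 ((0 : ℂ), y)) = 0 := fun y => by
        rw [← mfderiv_proj_comp_symm h0φ]
        refine t.openPartialHomeomorph_mdifferentiable.mfderiv_injective htF ?_
        refine ((hfd 0 h0φ htF (0, y)).symm.trans (hfw y)).trans ?_
        exact (map_zero _).symm
      have hframe : IsPositiveFrame (oS.at' (N.proj (φ.symm 0)))
          ![mfderiv (𝓡 4) (𝓡 2) N.proj (φ.symm 0)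
              (mfderiv 𝓘(ℝ, ℂ × ℂ) (𝓡 4) φ.symm 0 (ζ₁, (0 : ℂ))),
            mfderiv (𝓡 4) (𝓡 2) N.proj (φ.symm 0)
              (mfderiv 𝓘(ℝ, ℂ × ℂ) (𝓡 4) φ.symm 0 (ζ₂, (0 : ℂ)))] := by
        refine orientedFrame_det₂ (ht _ htF) ?_
        rw [← mfderiv_proj_comp_symm h0φ, ← mfderiv_proj_comp_symm h0φ]
        have e1 := (hfd 0 h0φ htF (ζ₁, 0)).symm.trans hζ₁
        have e2 := (hfd 0 h0φ htF (ζ₂, 0)).symm.trans hζ₂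
        refine lt_of_lt_of_eq (b := det₂ 1 Complex.I) (by simp [det₂]) ?_
        exact congrArg₂ det₂ e1.symm e2.symm
      have hiso := hφ _ (φ.symm_mem_source h0φ)
      have hE := φ.mfderiv_mfderiv_symm h0φ
      rcases lt_or_gt_of_ne hζ with hneg | hpos'
      · have h1 := hfib (φ.symm 0) hcrit _ _ _ _ (hker Complex.I) (hker 1) hframe
          (orientedFrame_det₄ hiso (by
            refine lt_of_lt_of_eq (b := - det₂ ζ₁ ζ₂) (by linarith) ?_
            rw [← det₄_prod_swap]
            exact (congr (congr (congr (congrArg det₄ (hE _)) (hE _)) (hE _)) (hE _)).symm))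
        have h2 := (alternating_apply_smul_add (ωN (φ.symm 0))
          (mfderiv 𝓘(ℝ, ℂ × ℂ) (𝓡 4) φ.symm 0 ((0 : ℂ), (1 : ℂ)))
          (mfderiv 𝓘(ℝ, ℂ × ℂ) (𝓡 4) φ.symm 0 ((0 : ℂ), Complex.I)) 0 1).2
        rw [zero_smul, one_smul, zero_add] at h2
        rw [h2] at h1
        have h3 : G 0 < 0 := by
          change 0 < -1 * G 0 at h1
          linarith
        exact mul_pos_of_neg_of_neg hneg h3
      · have h1 := hfib (φ.symm 0) hcrit _ _ _ _ (hker 1) (hker Complex.I) hframe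
          (orientedFrame_det₄ hiso (by
            refine lt_of_lt_of_eq hpos' ?_
            rw [← det₄_prod]
            exact (congr (congr (congr (congrArg det₄ (hE _)) (hE _)) (hE _)) (hE _)).symm))
        exact mul_pos hpos' h1
    refine ⟨0, ?_⟩
    filter_upwards [hsign, htarget, htev,
      (continuousAt_const.mul hGc).eventually_const_lt (u := 0) hG0] with w h1 h2 h3 h4 k hk hzero
    have h5 : 0 ≤ det₂ ζ₁ ζ₂ * H (0, w) := by
      obtain ⟨ρ, hρ, hρH⟩ := exists_pos_forall_apply_eq (ht _ h3) (ωS ((N.proj ∘ φ.symm) (0, w)))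
        (hpos _)
      rw [hfd _ h2 h3, hfd _ h2 h3] at h1
      simp only [hH, hρH]
      calc (0 : ℝ) ≤ ρ * _ := mul_nonneg hρ.le h1
        _ = _ := by ring
    have h6 : det₂ ζ₁ ζ₂ * (G (0, w) + k * H (0, w)) =
      det₂ ζ₁ ζ₂ * G (0, w) + k * (det₂ ζ₁ ζ₂ * H (0, w)) := by ring
    rw [hzero, mul_zero] at h6
    have h7 := mul_nonneg hk h5
    have h8 : 0 < det₂ ζ₁ ζ₂ * G (0, w) := h4
    linarith

end Local

/-- The condition of being a symplectic surface with respect to `Ω` at a single point. -/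
def IsSymplecticSurfaceAt {X : Type*} [TopologicalSpace X]
    [ChartedSpace (EuclideanSpace ℝ (Fin 4)) X] (Ω : TwoForm 4 X) (B : Set X) (x : X) : Prop :=
  ∃ φ : PartialDiffeomorph (𝓡 4) 𝓘(ℝ, ℂ × ℂ) X (ℂ × ℂ) ∞, x ∈ φ.source ∧
    (∀ y ∈ φ.source, y ∈ B ↔ (φ y).1 = 0) ∧
    ∀ v : TangentSpace (𝓡 4) x,
      (mfderiv (𝓡 4) 𝓘(ℝ, ℂ × ℂ) φ x v : ℂ × ℂ).1 = 0 → v ≠ 0 →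
        ∃ w : TangentSpace (𝓡 4) x,
          (mfderiv (𝓡 4) 𝓘(ℝ, ℂ × ℂ) φ x w : ℂ × ℂ).1 = 0 ∧ Ω x ![v, w] ≠ 0

/-- A form is non-degenerate on the line `z = 0` as soon as it does not vanish on one basis of its
tangent plane. -/
lemma isSymplecticSurfaceAt_symm {X : Type*} [TopologicalSpace X]
    [ChartedSpace (EuclideanSpace ℝ (Fin 4)) X] {Ω : TwoForm 4 X} {B : Set X}
    (φ : PartialDiffeomorph (𝓡 4) 𝓘(ℝ, ℂ × ℂ) X (ℂ × ℂ) ∞) {U : Set X} (hU : IsOpen U)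
    (hB : ∀ y ∈ φ.source ∩ U, y ∈ B ↔ (φ y).1 = 0) {z : ℂ × ℂ} (hz : z ∈ φ.target)
    (hzU : φ.symm z ∈ U)
    (hΩ : Ω (φ.symm z) ![mfderiv 𝓘(ℝ, ℂ × ℂ) (𝓡 4) φ.symm z ((0 : ℂ), (1 : ℂ)),
      mfderiv 𝓘(ℝ, ℂ × ℂ) (𝓡 4) φ.symm z ((0 : ℂ), Complex.I)] ≠ 0) :
    IsSymplecticSurfaceAt Ω B (φ.symm z) := by
  refine ⟨φ.restrict U hU, ⟨φ.symm_mem_source hz, hzU⟩, hB, fun v hv hv0 => ?_⟩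
  have hv' : (mfderiv (𝓡 4) 𝓘(ℝ, ℂ × ℂ) φ (φ.symm z) v : ℂ × ℂ).1 = 0 := hv
  set D : ℂ × ℂ →L[ℝ] EuclideanSpace ℝ (Fin 4) := mfderiv 𝓘(ℝ, ℂ × ℂ) (𝓡 4) φ.symm z with hD
  set y : ℂ := (mfderiv (𝓡 4) 𝓘(ℝ, ℂ × ℂ) φ (φ.symm z) v : ℂ × ℂ).2 with hy
  have hvD : v = D (0, y) := by
    obtain ⟨X, hX⟩ := φ.symm.openPartialHomeomorph_mdifferentiable.mfderiv_surjective hz v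
    have h1 := φ.mfderiv_mfderiv_symm hz X
    have h2 : (mfderiv (𝓡 4) 𝓘(ℝ, ℂ × ℂ) φ (φ.symm z) v : ℂ × ℂ) = X := by
      rw [← hX]; exact h1
    have h3 : ((0 : ℂ), y) = X := by
      rw [← h2]
      exact Prod.ext hv'.symm rfl
    rw [h3]
    exact hX.symm
  have hvs : v = y.re • D (0, 1) + y.im • D (0, Complex.I) := by
    rw [hvD, ← map_smul, ← map_smul, ← map_add]
    congr 1
    refine Prod.ext (by simp) ?_
    simp
  have hin : ∀ y : ℂ, (mfderiv (𝓡 4) 𝓘(ℝ, ℂ × ℂ) φ (φ.symm z) (D (0, y)) : ℂ × ℂ).1 = 0 :=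
    fun y => congrArg Prod.fst (φ.mfderiv_mfderiv_symm hz ((0 : ℂ), y))
  obtain ⟨h1, h2⟩ := alternating_apply_smul_add (V := EuclideanSpace ℝ (Fin 4)) (Ω (φ.symm z))
    (D (0, 1)) (D (0, Complex.I)) y.re y.im
  by_cases hre : y.re = 0
  · refine ⟨D (0, 1), hin 1, ?_⟩
    rw [hvs]
    refine ne_of_eq_of_ne h2 (mul_ne_zero (neg_ne_zero.2 fun him => hv0 ?_) hΩ)
    rw [hvs, hre, him, zero_smul, zero_smul, add_zero]
    rfl
  · refine ⟨D (0, Complex.I), hin Complex.I, ?_⟩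
    rw [hvs]
    exact ne_of_eq_of_ne h1 (mul_ne_zero hre hΩ)

theorem mainTheorem3 (oS : ManifoldOrientation 2 S2)
    (M M' : FourManifoldOverS2.{u}) (N N₀ : FourManifoldOverS2.{v})
    (hM : IsSLF oS M)
    (hM' : IsFiberedBlowUp oS M' M)
    (hN₀ : IsSymplecticFiberBundle N₀)
    (hN : IsBlowUp N N₀)
    (κ : M' → N) (hκ : IsBranchedCovering κ)
    (hfactor : ∀ x, N.proj (κ x) = M'.proj x)
    (hB : Disjoint (nonVerticalBranchLocus κ) (critSet (m := 4) (n := 2) N.proj))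
    (ωN : TwoForm 4 N) (hωN : IsSymplecticForm ωN) (hfib : HasSymplecticFibers oS N ωN)
    (ωS : TwoForm 2 S2) (hωS : IsSymplecticForm ωS) (hpos : IsPositiveForm oS ωS) :
    ∃ k₀ : ℝ, ∀ k : ℝ, k₀ ≤ k →
      IsSymplecticSurface (fun x => ωN x + k • TwoForm.pullback (m := 4) ωS N.proj x)
        (nonVerticalBranchLocus κ) := by

  have hmono := hM'.isMonomialAt hM
  have := hM'.compactSpace hM
  have hcomp : IsCompact (nonVerticalBranchLocus κ) := by
    have : IsCompact (univ : Set N) := by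
      rw [← hκ.surjective.range_eq]
      exact isCompact_range hκ.contMDiff.continuous
    exact this.of_isClosed_subset hκ.isClosed_nonVerticalBranchLocus (subset_univ _)
  suffices h : ∃ k₀ : ℝ, ∀ k : ℝ, k₀ ≤ k → ∀ x ∈ nonVerticalBranchLocus κ,
      x ∈ nonVerticalBranchLocus κ →
      IsSymplecticSurfaceAt (fun x => ωN x + k • TwoForm.pullback (m := 4) ωS N.proj x)
        (nonVerticalBranchLocus κ) x by
    obtain ⟨k₀, hk₀⟩ := h
    exact ⟨k₀, fun k hk x hx => hk₀ k hk x hx hx⟩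
  refine hcomp.induction_on (p := fun S => ∃ k₀ : ℝ, ∀ k : ℝ, k₀ ≤ k → ∀ x ∈ S,
      x ∈ nonVerticalBranchLocus κ →
      IsSymplecticSurfaceAt (fun x => ωN x + k • TwoForm.pullback (m := 4) ωS N.proj x)
        (nonVerticalBranchLocus κ) x) ⟨0, by simp⟩ ?_ ?_ ?_
  · rintro S T hST ⟨k₀, hk₀⟩
    exact ⟨k₀, fun k hk x hx => hk₀ k hk x (hST hx)⟩
  · rintro S T ⟨k₁, hk₁⟩ ⟨k₂, hk₂⟩
    refine ⟨max k₁ k₂, fun k hk x hx => ?_⟩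
    rcases hx with hx | hx
    · exact hk₁ k ((le_max_left _ _).trans hk) x hx
    · exact hk₂ k ((le_max_right _ _).trans hk) x hx
  · intro P hP
    obtain ⟨φ, Q, ψ, b, r, hφ, hPφ, hP0, hQP, hψ, hQψ, hQ0, hb, hmaps, hmodel, hr, hball, hloc⟩ :=
      hκ.exists_model hP.1
    have h0φ : 0 ∈ φ.target := hball (Metric.mem_ball_self hr)
    have h0ψ : 0 ∈ ψ.target := hQ0 ▸ ψ.mem_target hQψ
    have hPs : φ.symm 0 = P := by rw [← hP0, φ.symm_apply hPφ]
    have hcrit : φ.symm 0 ∉ critSet (m := 4) (n := 2) N.proj := by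
      rw [hPs]
      exact hB.notMem_of_mem_left hP
    obtain ⟨k₀, hk₀⟩ := eventually_perturbed_ne_zero hfactor hmono hωN hfib hωS hpos hφ hψ hmaps
      hmodel hb h0φ h0ψ hcrit
    obtain ⟨δ, hδ, hδk⟩ := Metric.eventually_nhds_iff_ball.1 hk₀
    have hU : IsOpen (φ.source ∩ φ ⁻¹' (Metric.ball 0 r ∩ Metric.ball 0 δ)) :=
      φ.contMDiffOn.continuousOn.isOpen_inter_preimage φ.open_source
        (Metric.isOpen_ball.inter Metric.isOpen_ball)
    refine ⟨_, mem_nhdsWithin_of_mem_nhds (hU.mem_nhds ⟨hPφ, ?_⟩), k₀, fun k hk x hx hxB => ?_⟩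
    · rw [mem_preimage, hP0]
      exact ⟨Metric.mem_ball_self hr, Metric.mem_ball_self hδ⟩
    · have hnv : ∀ y ∈ φ.source ∩ (φ.source ∩ φ ⁻¹' (Metric.ball 0 r ∩ Metric.ball 0 δ)),
          y ∈ nonVerticalBranchLocus κ ↔ (φ y).1 = 0 := by
        rintro y ⟨hy, -, hyr, -⟩
        rw [← hloc y hy hyr]
        refine ⟨fun h => h.1, fun h => ?_⟩
        exact (mem_nonVerticalBranchLocus_iff hP.1 hPφ hP0 hr hball hloc hy hyr h).2 hP
      have hx0 := (hnv x ⟨hx.1, hx⟩).1 hxB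
      have hxs : φ.symm (0, (φ x).2) = x := by
        rw [← hx0, Prod.mk.eta, φ.symm_apply hx.1]
      have hz : ((0 : ℂ), (φ x).2) ∈ φ.target := by
        rw [← hx0, Prod.mk.eta]
        exact φ.mem_target hx.1
      have hw : (φ x).2 ∈ Metric.ball (0 : ℂ) δ := by
        have := hx.2.2
        rw [mem_ball_zero_iff] at this ⊢
        exact (norm_snd_le _).trans_lt this
      have := isSymplecticSurfaceAt_symm
        (Ω := fun x => ωN x + k • TwoForm.pullback (m := 4) ωS N.proj x) φ hU hnv hz
        (by rw [hxs]; exact hx) (hδk _ hw k hk)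
      rwa [hxs] at this
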